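/- Let $m,n\ge 0$ be integers, let $K$ be a field extension of $\mathbb{C}$ and let $q,v_1,\dots,v_m\in K$. Assume that one of the following two conditions holds. (A) (Semisimple parameters.) $q\ne 0$; $1+q^2+\dots+q^{2N}\neq 0$ for all $0\le N<n$; $q^{2i}v_j\neq v_k$ for all $j\neq k$ and all integers $i$ with $-n<i<n$; $v_j\neq 0$ for all $j$; and, if $n\ge 2$, $q^2\neq 1$. (B) (Generic parameters.) $q,v_1,\dots,v_m$ are algebraically independent over $\mathbb{C}$ (for example, $K=\mathbb{C}(q,v_1,\dots,v_m)$ with $q,v_1,\dots,v_m$ indeterminates). The cyclotomic Hecke algebra $H(m,1,n)$ is the associative unital $K$-algebra generated by $\tau,\sigma_1,\dots,\sigma_{n-1}$ (with no generators, i.e. $H(m,1,0)=K$, for $n=0$) subject to the relations $\sigma_i\sigma_{i+1}\sigma_i=\sigma_{i+1}\sigma_i\sigma_{i+1}$; $\sigma_i\sigma_j=\sigma_j\sigma_i$ for $|i-j|>1$; $\tau\sigma_1\tau\sigma_1=\sigma_1\tau\sigma_1\tau$; $\tau\sigma_i=\sigma_i\tau$ for $i>1$; $\sigma_i^2=(q-q^{-1})\sigma_i+1$;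 and $(\tau-v_1)\cdots(\tau-v_m)=0$. An $m$-partition of $n$ is an $m$-tuple $\lambda=(\lambda_1,\dots,\lambda_m)$ of Young diagrams with $n$ nodes in total. A standard $m$-tableau $X$ of shape $\lambda$ is a bijective filling of the nodes of $\lambda$ by $1,\dots,n$ such that in each diagram the numbers increase along rows (to the right) and down columns. Denote by $c(X|i)=v_kq^{2(s-r)}$ the content of the node of $X$ containing $i$, where this node lies in row $r$ and column $s$ of the $k$-th diagram. Let $V_\lambda$ be the $K$-vector space with basis the standard $m$-tableaux of shape $\lambda$. For a standard $m$-tableau $X$ let $Xs_i$ be the filling obtained from $X$ by exchanging $i$ and $i+1$, interpreted as the vector $0\in V_\lambda$ if it is not standard. Then $c(X|i)\neq c(X|i+1)$ for every standard $m$-tableau $X$ with $n$ nodes and every $1\le i<n$, the formulas $$\tau X=c(X|1)\,X,\qquad \sigma_iX=-(q-q^{-1})\frac{c(X|i+1)}{c(X|i)-c(X|i+1)}\,X+\frac{q\,c(X|i+1)-q^{-1}c(X|i)}{c(X|i+1)-c(X|i)}\,Xs_i$$ define a representation of $H(m,1,n)$ on $V_\lambda$ for every $m$-partition $\lambda$ of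 $n$, and the following hold. 1. The representations $V_\lambda$ are irreducible and pairwise non-isomorphic. 2. $H(m,1,n)$ is finite-dimensional over $K$, and $\sum_{\lambda}(\dim_K V_\lambda)^2=\dim_K H(m,1,n)=n!\,m^n$, the sum being over all $m$-partitions $\lambda$ of $n$. 3. Every irreducible representation of $H(m,1,n)$ is isomorphic to some $V_\lambda$, and the algebra $H(m,1,n)$ is semisimple. -/

import Mathlib

namespace CyclotomicHecke

/-! ### The cyclotomic Hecke algebra `H(m,1,n)` -/

/-- The generators of `H(m,1,n)`: `τ` (present once `n ≥ 1`) and `σ₁, …, σ_{n-1}`.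
`sigma i` stands for `σ_{i+1}`, so `i + 1` runs over `1, …, n - 1`. -/
inductive Gen (n : ℕ) : Type
  | tau (h : 0 < n) : Gen n
  | sigma (i : ℕ) (h : i + 1 < n) : Gen n

section Algebra

variable {K : Type*} [Field K] {m : ℕ}

/-- `τ` in the free algebra. -/
abbrev freeTau (K : Type*) [Field K] {n : ℕ} (h : 0 < n) : FreeAlgebra K (Gen n) :=
  FreeAlgebra.ι K (Gen.tau h)

/-- `σ_{i+1}` in the free algebra. -/
abbrev freeSigma (K : Type*) [Field K] {n : ℕ} (i : ℕ) (h : i + 1 < n) :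
    FreeAlgebra K (Gen n) :=
  FreeAlgebra.ι K (Gen.sigma i h)

/-- The defining relations of `H(m,1,n)` with parameters `q` and `v₁, …, v_m`. -/
inductive Rel (q : K) (v : Fin m → K) (n : ℕ) :
    FreeAlgebra K (Gen n) → FreeAlgebra K (Gen n) → Prop
  | braid (i : ℕ) (h : i + 2 < n) :
      Rel q v n
        (freeSigma K i (by omega) * freeSigma K (i + 1) h * freeSigma K i (by omega))
        (freeSigma K (i + 1) h * freeSigma K i (by omega) * freeSigma K (i + 1) h)
  | comm (i j : ℕ) (hij : i + 1 < j) (h : j + 1 < n) :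
      Rel q v n
        (freeSigma K i (by omega) * freeSigma K j h)
        (freeSigma K j h * freeSigma K i (by omega))
  | tau_braid (h : 1 < n) :
      Rel q v n
        (freeTau K (by omega) * freeSigma K 0 h * freeTau K (by omega) * freeSigma K 0 h)
        (freeSigma K 0 h * freeTau K (by omega) * freeSigma K 0 h * freeTau K (by omega))
  | tau_comm (i : ℕ) (hi : 0 < i) (h : i + 1 < n) :
      Rel q v n
        (freeTau K (by omega) * freeSigma K i h)
        (freeSigma K i h * freeTau K (by omega))
  | quadratic (i : ℕ) (h : i + 1 < n) :
      Rel q v n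
        (freeSigma K i h ^ 2)
        ((q - q⁻¹) • freeSigma K i h + 1)
  | cyclotomic (h : 0 < n) :
      Rel q v n
        (List.ofFn fun j : Fin m => freeTau K h - algebraMap K (FreeAlgebra K (Gen n)) (v j)).prod
        0

/-- The cyclotomic Hecke algebra `H(m,1,n)` over `K` with parameters `q`, `v₁, …, v_m`. -/
abbrev HeckeAlgebra (q : K) (v : Fin m → K) (n : ℕ) : Type _ :=
  RingQuot (Rel q v n)

/-- The generator `τ` of `H(m,1,n)`. -/
noncomputable def tau (q : K) (v : Fin m → K) {n : ℕ} (h : 0 < n) : HeckeAlgebra q v n :=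
  RingQuot.mkAlgHom K (Rel q v n) (freeTau K h)

/-- The generator `σ_{i+1}` of `H(m,1,n)`. -/
noncomputable def sigma (q : K) (v : Fin m → K) {n : ℕ} (i : ℕ) (h : i + 1 < n) :
    HeckeAlgebra q v n :=
  RingQuot.mkAlgHom K (Rel q v n) (freeSigma K i h)

/-- The semisimplicity restrictions on the parameters: `q` is invertible,
`1 + q² + ⋯ + q^{2N} ≠ 0` for `N < n`, `q^{2i} v_j ≠ v_k` for `j ≠ k` and `-n < i < n`, and
`v_j ≠ 0`.  If `σ₁` is present, `q² ≠ 1` is needed for the denominators in the action of the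
`σ_i` on tableaux to be nonzero. -/
structure SemisimpleParameters (q : K) (v : Fin m → K) (n : ℕ) : Prop where
  q_ne_zero : q ≠ 0
  q_sq_ne_one : 2 ≤ n → q ^ 2 ≠ 1
  qsum_ne_zero : ∀ N : ℕ, N < n → ∑ i ∈ Finset.range (N + 1), q ^ (2 * i) ≠ 0
  separated : ∀ (i : ℤ) (j k : Fin m), j ≠ k → -(n : ℤ) < i → i < n →
    q ^ (2 * i) * v j - v k ≠ 0
  v_ne_zero : ∀ j, v j ≠ 0

/-- Generic parameters: `q, v₁, …, v_m` are indeterminates over `ℂ`, i.e. algebraically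
independent elements of the extension `K` of `ℂ`. -/
def GenericParameters [Algebra ℂ K] (q : K) (v : Fin m → K) : Prop :=
  AlgebraicIndependent ℂ (fun o : Option (Fin m) => o.elim q v)

end Algebra

/-! ### Young `m`-diagrams and standard `m`-tableaux -/

/-- `m`-partitions of length `n`. -/
@[ext]
structure MultiPartition (m n : ℕ) : Type where
  diagram : Fin m → YoungDiagram
  sum_card : ∑ k, (diagram k).card = n

theorem YoungDiagram_cells_subset (μ : YoungDiagram) :
    μ.cells ⊆ Finset.range μ.card ×ˢ Finset.range μ.card := by
  rintro ⟨i, j⟩ h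
  have hmem : (i, j) ∈ μ := h
  have h1 : (Finset.range (i + 1)).image (fun a => (a, j)) ⊆ μ.cells := by
    intro x hx
    obtain ⟨a, ha, rfl⟩ := Finset.mem_image.1 hx
    exact μ.up_left_mem (Nat.lt_succ_iff.1 (Finset.mem_range.1 ha)) le_rfl hmem
  have h2 : (Finset.range (j + 1)).image (fun a => (i, a)) ⊆ μ.cells := by
    intro x hx
    obtain ⟨a, ha, rfl⟩ := Finset.mem_image.1 hx
    exact μ.up_left_mem le_rfl (Nat.lt_succ_iff.1 (Finset.mem_range.1 ha)) hmem
  have c1 := Finset.card_le_card h1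
  have c2 := Finset.card_le_card h2
  rw [Finset.card_image_of_injective _ (fun a b hab => (Prod.ext_iff.1 hab).1),
    Finset.card_range] at c1
  rw [Finset.card_image_of_injective _ (fun a b hab => (Prod.ext_iff.1 hab).2),
    Finset.card_range] at c2
  exact Finset.mem_product.2 ⟨Finset.mem_range.2 c1, Finset.mem_range.2 c2⟩

instance instFiniteMultiPartition (m n : ℕ) : Finite (MultiPartition m n) := by
  let f : MultiPartition m n →
      (Fin m → {s : Finset (ℕ × ℕ) // s ∈ (Finset.range n ×ˢ Finset.range n).powerset}) :=
    fun lam k => ⟨(lam.diagram k).cells, by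
      have hk : (lam.diagram k).card ≤ n := by
        refine le_of_le_of_eq ?_ lam.sum_card
        exact Finset.single_le_sum (f := fun k => (lam.diagram k).card)
          (fun _ _ => Nat.zero_le _) (Finset.mem_univ k)
      refine Finset.mem_powerset.2 ((YoungDiagram_cells_subset _).trans ?_)
      exact Finset.product_subset_product (Finset.range_subset_range.2 hk)
        (Finset.range_subset_range.2 hk)⟩
  refine Finite.of_injective f fun a b hab => MultiPartition.ext (funext fun k => ?_)
  exact YoungDiagram.ext (congrArg Subtype.val (congrFun hab k))

noncomputable instance instFintypeMultiPartition (m n : ℕ) : Fintype (MultiPartition m n) :=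
  Fintype.ofFinite _

variable {m n : ℕ}

/-- The nodes of an `m`-partition: `⟨k, (r, s)⟩` is the node in line `r` and column `s` of the
`k`-th diagram. -/
abbrev Node (lam : MultiPartition m n) : Type :=
  Σ k : Fin m, {c : ℕ × ℕ // c ∈ lam.diagram k}

/-- A filling of the nodes by `1, …, n` (here `Fin n`: the element `i` is the number `i + 1`) is
standard if the entries ascend along the rows and down the columns of every diagram. -/
def IsStandard (lam : MultiPartition m n) (e : Node lam ≃ Fin n) : Prop :=
  (∀ (k : Fin m) (r s s' : ℕ) (h : (r, s) ∈ lam.diagram k) (h' : (r, s') ∈ lam.diagram k),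
    s < s' → e ⟨k, (r, s), h⟩ < e ⟨k, (r, s'), h'⟩) ∧
  (∀ (k : Fin m) (r r' s : ℕ) (h : (r, s) ∈ lam.diagram k) (h' : (r', s) ∈ lam.diagram k),
    r < r' → e ⟨k, (r, s), h⟩ < e ⟨k, (r', s), h'⟩)

/-- Standard `m`-tableaux of shape `lam`. -/
@[ext]
structure StandardTableau (lam : MultiPartition m n) : Type where
  entry : Node lam ≃ Fin n
  standard : IsStandard lam entry

/-! ### The representation on standard tableaux -/

section Action

variable {K : Type*} [Field K]

/-- The content `v_k q^{2(s-r)}` of a node in line `r` and column `s` of the `k`-th diagram. -/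
def nodeContent (q : K) (v : Fin m → K) {lam : MultiPartition m n} (x : Node lam) : K :=
  v x.1 * q ^ (2 * ((x.2.1.2 : ℤ) - (x.2.1.1 : ℤ)))

/-- `c(X | i + 1)`: the content of the node of `X` carrying the number `i + 1`. -/
def content (q : K) (v : Fin m → K) {lam : MultiPartition m n} (X : StandardTableau lam)
    (i : Fin n) : K :=
  nodeContent q v (X.entry.symm i)

/-- The space `V_lam` with basis the standard `m`-tableaux of shape `lam`. -/
abbrev TableauSpace (K : Type*) [Field K] (lam : MultiPartition m n) : Type _ :=
  StandardTableau lam →₀ K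

open Classical in
/-- The vector `X s_{i+1}`: exchange the numbers `i + 1` and `i + 2` in `X`; the result is `0` if
the new filling is not standard. -/
noncomputable def swapVector (K : Type*) [Field K] {lam : MultiPartition m n}
    (X : StandardTableau lam) (i : ℕ) (h : i + 1 < n) : TableauSpace K lam :=
  if hs : IsStandard lam (X.entry.trans (Equiv.swap ⟨i, by omega⟩ ⟨i + 1, h⟩)) then
    Finsupp.single ⟨X.entry.trans (Equiv.swap ⟨i, by omega⟩ ⟨i + 1, h⟩), hs⟩ 1
  else 0

/-- The operator by which `τ` acts on `V_lam`: `X ↦ c(X|1) X`. -/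
noncomputable def tauOp (q : K) (v : Fin m → K) (lam : MultiPartition m n) (h : 0 < n) :
    Module.End K (TableauSpace K lam) :=
  Finsupp.linearCombination K fun X : StandardTableau lam =>
    content q v X ⟨0, h⟩ • Finsupp.single X (1 : K)

/-- The operator by which `σ_i` acts on `V_lam`:
`X ↦ - (q - q⁻¹) c(X|i+1) / (c(X|i) - c(X|i+1)) X
  + (q c(X|i+1) - q⁻¹ c(X|i)) / (c(X|i+1) - c(X|i)) X s_i`
(with indices shifted by one). -/
noncomputable def sigmaOp (q : K) (v : Fin m → K) (lam : MultiPartition m n) (i : ℕ)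
    (h : i + 1 < n) : Module.End K (TableauSpace K lam) :=
  Finsupp.linearCombination K fun X : StandardTableau lam =>
    (-((q - q⁻¹) * (content q v X ⟨i + 1, h⟩ /
        (content q v X ⟨i, by omega⟩ - content q v X ⟨i + 1, h⟩)))) • Finsupp.single X (1 : K)
      + ((q * content q v X ⟨i + 1, h⟩ - q⁻¹ * content q v X ⟨i, by omega⟩) /
        (content q v X ⟨i + 1, h⟩ - content q v X ⟨i, by omega⟩)) • swapVector K X i h

end Action

/-! ### Representations of an algebra as modules -/

section AsModule

variable {K A V : Type*} [Field K] [Ring A] [Algebra K A] [AddCommGroup V] [Module K V]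

/-- The space of a representation `ρ : A → End V`, as an `A`-module with `a • x = ρ a x`. -/
def AsModule (_ρ : A →ₐ[K] Module.End K V) : Type _ := V

instance (ρ : A →ₐ[K] Module.End K V) : AddCommGroup (AsModule ρ) :=
  inferInstanceAs (AddCommGroup V)

instance (ρ : A →ₐ[K] Module.End K V) : Module K (AsModule ρ) :=
  inferInstanceAs (Module K V)

instance (ρ : A →ₐ[K] Module.End K V) : Module A (AsModule ρ) :=
  Module.compHom V ρ.toRingHom

end AsModule

end CyclotomicHecke

open CyclotomicHecke

/-!
The elements `σ_j ⋯ σ₁ τ^a σ₁ ⋯ σ_n` with `0 ≤ j ≤ n` and `0 ≤ a < m` generate `H(m,1,n+1)` as a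
right module over the image of `H(m,1,n)`, so the dimension of `H(m,1,n)` is at most `n! mⁿ`.

The formulas on tableaux are restrictions of formulas on sequences of nodes, on which the symmetric
group acts without leaving the basis; there the relations become identities between rational
functions of two or three contents. The Jucys–Murphy elements `J₁ = τ`, `J_{i+1} = σ_i J_i σ_i` act
on the basis vector `X` by the contents `c(X|i)`. The contents determine `X`, together with its
shape, so by interpolation the image of `H(m,1,n)` in the product of all `End V_λ` contains every
diagonal operator. Any two standard tableaux of the same shape are joined by exchanges of `i` and
`i + 1`, whose coefficients do not vanish, so the image also contains all matrix units and
`H(m,1,n)` maps onto the product.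

The Young lattice is a differential poset, and so is its `m`-th power, with `DU - UD = m`. Hence the
numbers of standard tableaux satisfy `∑ (dim V_λ)² = n! mⁿ`. Comparing dimensions, the map onto the
product is an isomorphism, and the rest is the representation theory of a product of matrix
algebras.
-/

namespace CyclotomicHecke

/-! ### The affine Hecke relations -/

section AffineHecke

variable {R A : Type*} [CommRing R] [Ring A] [Algebra R A]

/-- Elements `t, s 0, …, s (n - 2)` of an algebra which satisfy the relations of the affine Hecke
algebra: those of `τ, σ₁, …, σ_{n-1}`, with `q - q⁻¹` replaced by an arbitrary scalar `δ`, except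
for the polynomial equation of `τ`. The values `s i` with `n ≤ i + 1` are irrelevant. -/
structure IsAffineHeckeFamily (δ : R) (n : ℕ) (t : A) (s : ℕ → A) : Prop where
  braid : ∀ i, i + 2 < n → s i * s (i + 1) * s i = s (i + 1) * s i * s (i + 1)
  comm : ∀ i j, i + 1 < j → j + 1 < n → Commute (s i) (s j)
  tau_braid : 1 < n → t * s 0 * t * s 0 = s 0 * t * s 0 * t
  tau_comm : ∀ i, 0 < i → i + 1 < n → Commute t (s i)
  quadratic : ∀ i, i + 1 < n → s i ^ 2 = δ • s i + 1

/-- The product `s 0 * s 1 * ⋯ * s (k - 1)`. -/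
def ascProd (s : ℕ → A) : ℕ → A
  | 0 => 1
  | k + 1 => ascProd s k * s k

/-- The product `s (k - 1) * ⋯ * s 1 * s 0`. -/
def descProd (s : ℕ → A) : ℕ → A
  | 0 => 1
  | k + 1 => s k * descProd s k

theorem ascProd_succ' (s : ℕ → A) (k : ℕ) :
    ascProd s (k + 1) = s 0 * ascProd (fun i => s (i + 1)) k := by
  induction k with
  | zero => simp [ascProd]
  | succ k ih => rw [ascProd, ih, ascProd, mul_assoc]

theorem descProd_succ' (s : ℕ → A) (k : ℕ) :
    descProd s (k + 1) = descProd (fun i => s (i + 1)) k * s 0 := by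
  induction k with
  | zero => simp [descProd]
  | succ k ih => rw [descProd, ih, descProd, mul_assoc]

theorem commute_ascProd {s : ℕ → A} {x : A} {k : ℕ} (h : ∀ i < k, Commute x (s i)) :
    Commute x (ascProd s k) := by
  induction k with
  | zero => exact Commute.one_right x
  | succ k ih => exact (ih fun i hi => h i (by omega)).mul_right (h k (by omega))

theorem commute_descProd {s : ℕ → A} {x : A} {k : ℕ} (h : ∀ i < k, Commute x (s i)) :
    Commute x (descProd s k) := by
  induction k with
  | zero => exact Commute.one_right x
  | succ k ih => exact (h k (by omega)).mul_right (ih fun i hi => h i (by omega))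

theorem descProd_mem {B : Subalgebra R A} {s : ℕ → A} {k : ℕ} (h : ∀ i < k, s i ∈ B) :
    descProd s k ∈ B := by
  induction k with
  | zero => exact B.one_mem
  | succ k ih => exact B.mul_mem (h k (by omega)) (ih fun i hi => h i (by omega))

/-- The element `s (j - 1) ⋯ s 0 · t ^ a · s 0 ⋯ s (n - 1)`. -/
def cosetElement (t : A) (s : ℕ → A) (n j a : ℕ) : A :=
  descProd s j * t ^ a * ascProd s n

/-- The right `B`-module generated by the elements `cosetElement t s n j a` with `j ≤ n`. -/
def cosetSpan (t : A) (s : ℕ → A) (n : ℕ) (B : Subalgebra R A) : Submodule R A :=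
  Submodule.span R {x | ∃ j ≤ n, ∃ a, x = cosetElement t s n j a} * Subalgebra.toSubmodule B

section CosetSpan

variable {n : ℕ} {t : A} {s : ℕ → A} {B : Subalgebra R A}

theorem cosetElement_mul_mem {j : ℕ} (hj : j ≤ n) (a : ℕ) {b : A} (hb : b ∈ B) :
    cosetElement t s n j a * b ∈ cosetSpan t s n B :=
  Submodule.mul_mem_mul (Submodule.subset_span ⟨j, hj, a, rfl⟩) hb

theorem cosetElement_mem {j : ℕ} (hj : j ≤ n) (a : ℕ) :
    cosetElement t s n j a ∈ cosetSpan t s n B := by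
  simpa only [mul_one] using cosetElement_mul_mem hj a B.one_mem

theorem cosetSpan_mul_mem {x b : A} (hx : x ∈ cosetSpan t s n B) (hb : b ∈ B) :
    x * b ∈ cosetSpan t s n B := by
  have h : x * b ∈ cosetSpan t s n B * Subalgebra.toSubmodule B := Submodule.mul_mem_mul hx hb
  rwa [cosetSpan, mul_assoc, B.isIdempotentElem_toSubmodule.eq] at h

theorem mul_mem_cosetSpan {g : A}
    (hg : ∀ j ≤ n, ∀ a, g * cosetElement t s n j a ∈ cosetSpan t s n B) {x : A}
    (hx : x ∈ cosetSpan t s n B) : g * x ∈ cosetSpan t s n B := by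
  have hspan : ∀ y ∈ Submodule.span R {x | ∃ j ≤ n, ∃ a, x = cosetElement t s n j a},
      g * y ∈ cosetSpan t s n B := by
    refine fun y hy => (Submodule.span_le (p := (cosetSpan t s n B).comap
      (LinearMap.mulLeft R g))).2 ?_ hy
    rintro _ ⟨j, hj, a, rfl⟩
    exact hg j hj a
  induction hx using Submodule.mul_induction_on' with
  | mem_mul_mem y hy b hb =>
    rw [← mul_assoc]
    exact cosetSpan_mul_mem (hspan y hy) hb
  | add x _ y _ hx hy =>
    rw [mul_add]
    exact Submodule.add_mem _ hx hy

end CosetSpan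

namespace IsAffineHeckeFamily

variable {δ : R} {n : ℕ} {t : A} {s : ℕ → A}

theorem of_le (H : IsAffineHeckeFamily δ n t s) {k : ℕ} (hk : k ≤ n) :
    IsAffineHeckeFamily δ k t s where
  braid i h := H.braid i (by omega)
  comm i j hij h := H.comm i j hij (by omega)
  tau_braid h := H.tau_braid (by omega)
  tau_comm i hi h := H.tau_comm i hi (by omega)
  quadratic i h := H.quadratic i (by omega)

theorem mul_ascProd (H : IsAffineHeckeFamily δ (n + 1) t s) {i k : ℕ} (hik : i + 1 < k)
    (hk : k ≤ n) : s (i + 1) * ascProd s k = ascProd s k * s i := by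
  induction k, hik using Nat.le_induction with
  | base =>
    have hcomm : Commute (s (i + 1)) (ascProd s i) :=
      commute_ascProd fun j hj => (H.comm j (i + 1) (by omega) (by omega)).symm
    calc s (i + 1) * ascProd s (i + 2)
        = s (i + 1) * ascProd s i * (s i * s (i + 1)) := by simp only [ascProd, mul_assoc]
      _ = ascProd s i * (s (i + 1) * s i * s (i + 1)) := by
        rw [hcomm.eq]; simp only [mul_assoc]
      _ = ascProd s (i + 2) * s i := by
        rw [← H.braid i (by omega)]; simp only [ascProd, mul_assoc]
  | succ k _ ih =>
    rw [ascProd, ← mul_assoc, ih (by omega), mul_assoc, (H.comm i k (by omega) (by omega)).eq,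
      mul_assoc]

theorem mul_descProd (H : IsAffineHeckeFamily δ (n + 1) t s) {i k : ℕ} (hik : i + 1 < k)
    (hk : k ≤ n) : s i * descProd s k = descProd s k * s (i + 1) := by
  induction k, hik using Nat.le_induction with
  | base =>
    have hcomm : Commute (s (i + 1)) (descProd s i) :=
      commute_descProd fun j hj => (H.comm j (i + 1) (by omega) (by omega)).symm
    calc s i * descProd s (i + 2)
        = s i * s (i + 1) * s i * descProd s i := by simp only [descProd, mul_assoc]
      _ = s (i + 1) * s i * (s (i + 1) * descProd s i) := by
        rw [H.braid i (by omega), mul_assoc]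
      _ = descProd s (i + 2) * s (i + 1) := by
        rw [hcomm.eq]; simp only [descProd, mul_assoc]
  | succ k _ ih =>
    rw [descProd, ← mul_assoc, (H.comm i k (by omega) (by omega)).eq, mul_assoc, ih (by omega),
      mul_assoc]

theorem descProd_shift_mul_ascProd (H : IsAffineHeckeFamily δ (n + 1) t s) {j : ℕ} (hj : j < n) :
    descProd (fun i => s (i + 1)) j * ascProd s n = ascProd s n * descProd s j := by
  induction j with
  | zero => simp [descProd]
  | succ j ih =>
    rw [descProd, mul_assoc, ih (by omega), ← mul_assoc, H.mul_ascProd hj le_rfl, mul_assoc,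
      descProd]

theorem mul_sub_self (H : IsAffineHeckeFamily δ n t s) {i : ℕ} (hi : i + 1 < n) :
    s i * (s i - δ • 1) = 1 := by
  rw [mul_sub, ← sq, H.quadratic i hi, mul_smul_comm, mul_one, add_sub_cancel_left]

theorem sub_mul_self (H : IsAffineHeckeFamily δ n t s) {i : ℕ} (hi : i + 1 < n) :
    (s i - δ • 1) * s i = 1 := by
  rw [sub_mul, ← sq, H.quadratic i hi, smul_mul_assoc, one_mul, add_sub_cancel_left]

-- `s 0 * t * s 0` commutes with `t`; multiply `s 0 t s 0 t ^ a = t ^ a s 0 t s 0` by the inverse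
-- `s 0 - δ` of `s 0` on both sides.
theorem tau_mul_sigma_mul_tau_pow_mul_inv (H : IsAffineHeckeFamily δ n t s) (hn : 1 < n) (a : ℕ) :
    t * s 0 * t ^ a * (s 0 - δ • 1) = (s 0 - δ • 1) * t ^ a * s 0 * t := by
  have hcomm : Commute (s 0 * t * s 0) (t ^ a) := Commute.pow_right
    (by simpa only [Commute, SemiconjBy, ← mul_assoc] using (H.tau_braid hn).symm) a
  calc t * s 0 * t ^ a * (s 0 - δ • 1)
      = (s 0 - δ • 1) * s 0 * t * s 0 * t ^ a * (s 0 - δ • 1) := by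
        rw [H.sub_mul_self hn, one_mul]
    _ = (s 0 - δ • 1) * (s 0 * t * s 0 * t ^ a) * (s 0 - δ • 1) := by simp only [mul_assoc]
    _ = (s 0 - δ • 1) * t ^ a * s 0 * t * (s 0 * (s 0 - δ • 1)) := by
        rw [hcomm.eq]; simp only [mul_assoc]
    _ = (s 0 - δ • 1) * t ^ a * s 0 * t := by rw [H.mul_sub_self hn, mul_one]

theorem tau_mul_sigma_mul_tau_pow_mul_sigma (H : IsAffineHeckeFamily δ n t s) (hn : 1 < n)
    (a : ℕ) :
    t * s 0 * t ^ a * s 0 =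
      s 0 * t ^ a * s 0 * t - δ • (t ^ a * s 0 * t) + δ • (t * s 0 * t ^ a) := by
  have h := H.tau_mul_sigma_mul_tau_pow_mul_inv hn a
  simp only [mul_sub, sub_mul, mul_smul_comm, smul_mul_assoc, mul_one, one_mul] at h
  exact eq_add_of_sub_eq h

variable {B : Subalgebra R A}

theorem sigma_mul_cosetElement_self (i a : ℕ) :
    s i * cosetElement t s n i a = cosetElement t s n (i + 1) a := by
  simp only [cosetElement, descProd, mul_assoc]

theorem sigma_mul_cosetElement_succ (H : IsAffineHeckeFamily δ (n + 1) t s) {i : ℕ} (hi : i < n)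
    (a : ℕ) :
    s i * cosetElement t s n (i + 1) a =
      δ • cosetElement t s n (i + 1) a + cosetElement t s n i a := by
  simp only [cosetElement, descProd, mul_assoc]
  rw [← mul_assoc, ← sq, H.quadratic i (by omega), add_mul, one_mul, smul_mul_assoc]

theorem sigma_succ_mul_pow_mul_ascProd (H : IsAffineHeckeFamily δ (n + 1) t s) {i : ℕ}
    (hi : i + 1 < n) (a : ℕ) :
    s (i + 1) * (t ^ a * ascProd s n) = t ^ a * ascProd s n * s i := by
  have hcomm : Commute (s (i + 1)) (t ^ a) :=
    (H.tau_comm (i + 1) (by omega) (by omega)).symm.pow_right a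
  rw [← mul_assoc, hcomm.eq, mul_assoc, H.mul_ascProd hi le_rfl, mul_assoc]

theorem sigma_mul_cosetElement_of_lt (H : IsAffineHeckeFamily δ (n + 1) t s) {i j : ℕ}
    (hij : i + 1 < j) (hj : j ≤ n) (a : ℕ) :
    s i * cosetElement t s n j a = cosetElement t s n j a * s i := by
  rw [cosetElement, mul_assoc, ← mul_assoc, H.mul_descProd hij hj, mul_assoc,
    H.sigma_succ_mul_pow_mul_ascProd (by omega), mul_assoc, mul_assoc, mul_assoc]

theorem sigma_succ_mul_cosetElement_of_gt (H : IsAffineHeckeFamily δ (n + 1) t s) {i j : ℕ}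
    (hij : j ≤ i) (hi : i + 1 < n) (a : ℕ) :
    s (i + 1) * cosetElement t s n j a = cosetElement t s n j a * s i := by
  have hcomm : Commute (s (i + 1)) (descProd s j) :=
    commute_descProd fun l hl => (H.comm l (i + 1) (by omega) (by omega)).symm
  rw [cosetElement, mul_assoc, ← mul_assoc, hcomm.eq, mul_assoc,
    H.sigma_succ_mul_pow_mul_ascProd hi]
  simp only [mul_assoc]

theorem sigma_mul_mem_cosetSpan (H : IsAffineHeckeFamily δ (n + 1) t s)
    (hB : ∀ i, i + 1 < n → s i ∈ B) {i : ℕ} (hi : i < n) {x : A} (hx : x ∈ cosetSpan t s n B) :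
    s i * x ∈ cosetSpan t s n B := by
  refine mul_mem_cosetSpan (fun j hj a => ?_) hx
  rcases lt_trichotomy i j with hij | rfl | hij
  · obtain hlt | rfl := (Nat.succ_le_of_lt hij).lt_or_eq
    · rw [H.sigma_mul_cosetElement_of_lt hlt hj]
      exact cosetElement_mul_mem hj a (hB i (by omega))
    · rw [H.sigma_mul_cosetElement_succ hi]
      exact Submodule.add_mem _ (Submodule.smul_mem _ _ (cosetElement_mem hj a))
        (cosetElement_mem hi.le a)
  · rw [sigma_mul_cosetElement_self]
    exact cosetElement_mem hi a
  · obtain ⟨i, rfl⟩ := Nat.exists_eq_add_one_of_ne_zero (Nat.ne_zero_of_lt hij)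
    rw [H.sigma_succ_mul_cosetElement_of_gt (by omega) hi]
    exact cosetElement_mul_mem hj a (hB i hi)

theorem tau_mul_cosetElement_zero (a : ℕ) :
    t * cosetElement t s n 0 a = cosetElement t s n 0 (a + 1) := by
  simp only [cosetElement, descProd, one_mul, pow_succ', mul_assoc]

theorem descProd_shift_mul_mul_ascProd_shift (H : IsAffineHeckeFamily δ (n + 2) t s) {j : ℕ}
    (hj : j ≤ n) (k l : ℕ) :
    descProd (fun i => s (i + 1)) j * (t ^ k * s 0 * t ^ l) * ascProd (fun i => s (i + 1)) n =
      cosetElement t s (n + 1) 0 k * (descProd s j * t ^ l) := by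
  set d := descProd (fun i => s (i + 1)) j
  set c := ascProd (fun i => s (i + 1)) n
  have hdt : Commute (t ^ k) d := (commute_descProd fun i _ =>
    H.tau_comm (i + 1) (by omega) (by omega)).pow_left k
  have hct : Commute (t ^ l) c := (commute_ascProd fun i _ =>
    H.tau_comm (i + 1) (by omega) (by omega)).pow_left l
  have hpass : d * (s 0 * c) = ascProd s (n + 1) * descProd s j := by
    rw [← ascProd_succ']
    exact H.descProd_shift_mul_ascProd (by omega)
  calc d * (t ^ k * s 0 * t ^ l) * c
      = d * t ^ k * s 0 * (t ^ l * c) := by simp only [mul_assoc]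
    _ = t ^ k * (d * (s 0 * c)) * t ^ l := by rw [← hdt.eq, hct.eq]; simp only [mul_assoc]
    _ = cosetElement t s (n + 1) 0 k * (descProd s j * t ^ l) := by
        rw [hpass]; simp only [cosetElement, descProd, one_mul, mul_assoc]

theorem tau_mul_cosetElement_succ (H : IsAffineHeckeFamily δ (n + 2) t s) {j : ℕ} (hj : j ≤ n)
    (a : ℕ) :
    t * cosetElement t s (n + 1) (j + 1) a =
      cosetElement t s (n + 1) (j + 1) a * t
        - δ • (cosetElement t s (n + 1) 0 a * (descProd s j * t))
        + δ • (cosetElement t s (n + 1) 0 1 * (descProd s j * t ^ a)) := by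
  have ha := H.descProd_shift_mul_mul_ascProd_shift hj a 1
  have h1 := H.descProd_shift_mul_mul_ascProd_shift hj 1 a
  rw [pow_one] at ha h1
  rw [← ha, ← h1, cosetElement, ascProd_succ', descProd_succ']
  set d := descProd (fun i => s (i + 1)) j
  set c := ascProd (fun i => s (i + 1)) n
  have hdt : t * d = d * t :=
    (commute_descProd fun i _ => H.tau_comm (i + 1) (by omega) (by omega)).eq
  have hct : t * c = c * t :=
    (commute_ascProd fun i _ => H.tau_comm (i + 1) (by omega) (by omega)).eq
  calc t * (d * s 0 * t ^ a * (s 0 * c)) = t * d * (s 0 * t ^ a * s 0) * c := by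
        simp only [mul_assoc]
    _ = d * (t * s 0 * t ^ a * s 0) * c := by rw [hdt]; simp only [mul_assoc]
    _ = _ := by
        rw [H.tau_mul_sigma_mul_tau_pow_mul_sigma (by omega)]
        simp only [mul_add, mul_sub, add_mul, sub_mul, mul_smul_comm, smul_mul_assoc, mul_assoc,
          hct]

theorem tau_mul_mem_cosetSpan (H : IsAffineHeckeFamily δ (n + 1) t s) (hBt : 0 < n → t ∈ B)
    (hB : ∀ i, i + 1 < n → s i ∈ B) {x : A} (hx : x ∈ cosetSpan t s n B) :
    t * x ∈ cosetSpan t s n B := by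
  refine mul_mem_cosetSpan (fun j hj a => ?_) hx
  obtain - | j := j
  · rw [tau_mul_cosetElement_zero]
    exact cosetElement_mem hj _
  · obtain ⟨n, rfl⟩ := Nat.exists_eq_add_one_of_ne_zero (by omega : n ≠ 0)
    have ht : t ∈ B := hBt n.succ_pos
    have hd : descProd s j ∈ B := descProd_mem fun i _ => hB i (by omega)
    rw [H.tau_mul_cosetElement_succ (by omega)]
    refine Submodule.add_mem _ (Submodule.sub_mem _ ?_ (Submodule.smul_mem _ _ ?_))
      (Submodule.smul_mem _ _ ?_)
    · exact cosetElement_mul_mem hj a ht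
    · exact cosetElement_mul_mem (Nat.zero_le _) a (B.mul_mem hd ht)
    · exact cosetElement_mul_mem (Nat.zero_le _) 1 (B.mul_mem hd (B.pow_mem ht a))

theorem one_mem_cosetSpan (H : IsAffineHeckeFamily δ (n + 1) t s)
    (hB : ∀ i, i + 1 < n → s i ∈ B) : (1 : A) ∈ cosetSpan t s n B := by
  have hcancel : ∀ i < n, ∀ x, s i * x ∈ cosetSpan t s n B → x ∈ cosetSpan t s n B := by
    intro i hi x hx
    have hinv : x = s i * (s i * x) - δ • (s i * x) := by
      simpa only [sub_mul, smul_mul_assoc, one_mul, mul_assoc, mul_sub, mul_smul_comm] using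
        (congrArg (· * x) (H.mul_sub_self (i := i) (by omega))).symm
    rw [hinv]
    exact Submodule.sub_mem _ (H.sigma_mul_mem_cosetSpan hB hi hx) (Submodule.smul_mem _ _ hx)
  have hasc : ∀ k ≤ n, ∀ x, ascProd s k * x ∈ cosetSpan t s n B → x ∈ cosetSpan t s n B := by
    intro k
    induction k with
    | zero => intro _ x hx; simpa only [ascProd, one_mul] using hx
    | succ k ih =>
      intro hk x hx
      rw [ascProd, mul_assoc] at hx
      exact hcancel k hk x (ih (by omega) _ hx)
  refine hasc n le_rfl 1 ?_
  simpa only [cosetElement, descProd, pow_zero, one_mul, mul_one] using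
    cosetElement_mem (B := B) (s := s) (Nat.zero_le n) 0

end IsAffineHeckeFamily

end AffineHecke

/-! ### The upper bound for the dimension -/

section DimensionBound

open Polynomial

theorem mul_mem_of_mem_adjoin {R A : Type*} [CommSemiring R] [Semiring A] [Algebra R A] {S : Set A}
    {U : Submodule R A} (hU : ∀ g ∈ S, ∀ x ∈ U, g * x ∈ U) {y : A} (hy : y ∈ Algebra.adjoin R S) :
    ∀ x ∈ U, y * x ∈ U := by
  induction hy using Algebra.adjoin_induction with
  | mem y hy => exact hU y hy
  | algebraMap r =>
    intro x hx
    rw [← Algebra.smul_def]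
    exact U.smul_mem r hx
  | add y z _ _ hy hz =>
    intro x hx
    rw [add_mul]
    exact U.add_mem (hy x hx) (hz x hx)
  | mul y z _ _ hy hz =>
    intro x hx
    rw [mul_assoc]
    exact hy _ (hz x hx)

theorem pow_mem_span_pow_lt_natDegree {R A : Type*} [CommRing R] [Semiring A] [Algebra R A] {x : A}
    {p : R[X]} (hp : p.Monic) (hx : aeval x p = 0) (a : ℕ) :
    x ^ a ∈ Submodule.span R (Set.range fun i : Fin p.natDegree => x ^ (i : ℕ)) := by
  classical
  have hrange : (Set.range fun i : Fin p.natDegree => x ^ (i : ℕ)) =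
      (Finset.range p.natDegree).image (x ^ ·) := by
    ext y
    simp [Fin.exists_iff]
  rw [hrange, Submodule.span_range_natDegree_eq_adjoin hp hx]
  exact pow_mem (Algebra.self_mem_adjoin_singleton R x) a

variable {K : Type*} [Field K] {m n : ℕ}

theorem finrank_submodule_mul_le {A : Type*} [Ring A] [Algebra K A] [Module.Finite K A]
    (W B : Submodule K A) :
    Module.finrank K (W * B : Submodule K A) ≤ Module.finrank K W * Module.finrank K B := by
  rw [← Submodule.mulMap_range, ← Module.finrank_tensorProduct]
  exact LinearMap.finrank_range_le _

/-- The polynomial `(X - v₁) ⋯ (X - v_m)` which annihilates `τ`. -/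
noncomputable def tauPolynomial (v : Fin m → K) : K[X] :=
  ∏ j, (X - C (v j))

theorem prod_ofFn_sub_eq_aeval_tauPolynomial {A : Type*} [Ring A] [Algebra K A] (v : Fin m → K)
    (x : A) :
    (List.ofFn fun j => x - algebraMap K A (v j)).prod = aeval x (tauPolynomial v) := by
  rw [tauPolynomial, ← List.prod_ofFn, map_list_prod, List.map_ofFn]
  congr 2
  funext j
  simp

variable (q : K) (v : Fin m → K)

/-- The elements `σ_{i+1}` of `H(m,1,n)`, extended by `0` to all natural numbers `i`. -/
noncomputable def sigmaFamily (n i : ℕ) : HeckeAlgebra q v n :=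
  if h : i + 1 < n then sigma q v i h else 0

variable {q v}

namespace HeckeAlgebra

theorem sigmaFamily_of_lt {i : ℕ} (h : i + 1 < n) : sigmaFamily q v n i = sigma q v i h :=
  dif_pos h

theorem mkAlgHom_eq_of_rel {x y : FreeAlgebra K (Gen n)} (h : Rel q v n x y) :
    RingQuot.mkAlgHom K (Rel q v n) x = RingQuot.mkAlgHom K (Rel q v n) y :=
  RingQuot.mkAlgHom_rel K h

theorem isAffineHeckeFamily (hn : 0 < n) :
    IsAffineHeckeFamily (q - q⁻¹) n (tau q v hn) (sigmaFamily q v n) where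
  braid i h := by
    rw [sigmaFamily_of_lt (by omega), sigmaFamily_of_lt (by omega)]
    simpa only [sigma, map_mul] using mkAlgHom_eq_of_rel (Rel.braid (q := q) (v := v) i h)
  comm i j hij h := by
    rw [sigmaFamily_of_lt (by omega), sigmaFamily_of_lt (by omega)]
    simpa only [sigma, map_mul, commute_iff_eq] using
      mkAlgHom_eq_of_rel (Rel.comm (q := q) (v := v) i j hij h)
  tau_braid h := by
    rw [sigmaFamily_of_lt (by omega)]
    simpa only [tau, sigma, map_mul] using
      mkAlgHom_eq_of_rel (Rel.tau_braid (q := q) (v := v) h)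
  tau_comm i hi h := by
    rw [sigmaFamily_of_lt (by omega)]
    simpa only [tau, sigma, map_mul, commute_iff_eq] using
      mkAlgHom_eq_of_rel (Rel.tau_comm (q := q) (v := v) i hi h)
  quadratic i h := by
    rw [sigmaFamily_of_lt (by omega)]
    simpa only [sigma, map_pow, map_add, map_smul, map_one] using
      mkAlgHom_eq_of_rel (Rel.quadratic (q := q) (v := v) i h)

theorem aeval_tau_tauPolynomial (hn : 0 < n) : aeval (tau q v hn) (tauPolynomial v) = 0 := by
  have h := mkAlgHom_eq_of_rel (Rel.cyclotomic (q := q) (v := v) hn)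
  rwa [prod_ofFn_sub_eq_aeval_tauPolynomial, map_zero, ← aeval_algHom_apply] at h

theorem tau_pow_mem_span (hn : 0 < n) (a : ℕ) :
    tau q v hn ^ a ∈ Submodule.span K (Set.range fun i : Fin m => tau q v hn ^ (i : ℕ)) := by
  have hdeg : (tauPolynomial v).natDegree = m := by
    rw [tauPolynomial, natDegree_finsetProd_X_sub_C_eq_card, Finset.card_univ, Fintype.card_fin]
  have h := pow_mem_span_pow_lt_natDegree (monic_prod_X_sub_C v Finset.univ)
    (aeval_tau_tauPolynomial (q := q) hn) a
  rwa [← tauPolynomial, hdeg] at h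

section Lift

variable {A : Type*} [Ring A] [Algebra K A] {t : A} {s : ℕ → A}

/-- The universal property of `H(m,1,n)`: a homomorphism to `A` is given by elements of `A` which
satisfy the relations. For `n = 0` the element `t` is not used, so nothing is required of it. -/
noncomputable def lift (H : IsAffineHeckeFamily (q - q⁻¹) n t s)
    (ht : 0 < n → aeval t (tauPolynomial v) = 0) : HeckeAlgebra q v n →ₐ[K] A :=
  RingQuot.liftAlgHom K ⟨FreeAlgebra.lift K fun
    | Gen.tau _ => t
    | Gen.sigma i _ => s i, by
    intro x y hxy
    cases hxy with
    | braid i h => simpa using H.braid i h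
    | comm i j hij h => simpa using (H.comm i j hij h).eq
    | tau_braid h => simpa using H.tau_braid h
    | tau_comm i hi h => simpa using (H.tau_comm i hi h).eq
    | quadratic i h => simpa using H.quadratic i h
    | cyclotomic h =>
      rw [prod_ofFn_sub_eq_aeval_tauPolynomial, ← aeval_algHom_apply, map_zero]
      simpa using ht h⟩

theorem lift_tau (H : IsAffineHeckeFamily (q - q⁻¹) n t s)
    (ht : 0 < n → aeval t (tauPolynomial v) = 0) (hn : 0 < n) : lift H ht (tau q v hn) = t := by
  simp [lift, tau]

theorem lift_sigma (H : IsAffineHeckeFamily (q - q⁻¹) n t s)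
    (ht : 0 < n → aeval t (tauPolynomial v) = 0) {i : ℕ} (hi : i + 1 < n) :
    lift H ht (sigma q v i hi) = s i := by
  simp [lift, sigma]

end Lift

theorem eq_top_of_generators_mul_mem {U : Submodule K (HeckeAlgebra q v n)} (h1 : 1 ∈ U)
    (htau : ∀ (h : 0 < n), ∀ x ∈ U, tau q v h * x ∈ U)
    (hsigma : ∀ (i : ℕ) (h : i + 1 < n), ∀ x ∈ U, sigma q v i h * x ∈ U) : U = ⊤ := by
  have hgen : Algebra.adjoin K
      (RingQuot.mkAlgHom K (Rel q v n) '' Set.range (FreeAlgebra.ι K)) = ⊤ := by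
    rw [← AlgHom.map_adjoin, FreeAlgebra.adjoin_range_ι, Algebra.map_top]
    exact (AlgHom.range_eq_top _).2 (RingQuot.mkAlgHom_surjective K _)
  refine Submodule.eq_top_iff'.2 fun y => mul_one y ▸ mul_mem_of_mem_adjoin ?_
    (hgen ▸ Algebra.mem_top : y ∈ Algebra.adjoin K _) 1 h1
  rintro _ ⟨_, ⟨g | g, rfl⟩, rfl⟩
  exacts [htau _, hsigma _ _]

/-- The natural homomorphism from `H(m,1,n)` to `H(m,1,n+1)`. -/
noncomputable def inclusion (q : K) (v : Fin m → K) (n : ℕ) :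
    HeckeAlgebra q v n →ₐ[K] HeckeAlgebra q v (n + 1) :=
  lift ((isAffineHeckeFamily n.succ_pos).of_le n.le_succ)
    fun _ => aeval_tau_tauPolynomial n.succ_pos

theorem cosetSpan_inclusion_eq_top :
    cosetSpan (tau q v n.succ_pos) (sigmaFamily q v (n + 1)) n (inclusion q v n).range = ⊤ := by
  have H := isAffineHeckeFamily (q := q) (v := v) n.succ_pos
  have htau : 0 < n → tau q v n.succ_pos ∈ (inclusion q v n).range :=
    fun h => ⟨tau q v h, lift_tau _ _ h⟩
  have hsigma : ∀ i, i + 1 < n → sigmaFamily q v (n + 1) i ∈ (inclusion q v n).range :=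
    fun i h => ⟨sigma q v i h, lift_sigma _ _ h⟩
  refine eq_top_of_generators_mul_mem (H.one_mem_cosetSpan hsigma)
    (fun _ x hx => H.tau_mul_mem_cosetSpan htau hsigma hx) fun i h x hx => ?_
  rw [← sigmaFamily_of_lt h]
  exact H.sigma_mul_mem_cosetSpan hsigma (by omega) hx

/-- The `(n + 1) m` coset elements which generate `H(m,1,n+1)` as a right module over the image of
`H(m,1,n)`. -/
noncomputable def cosetGenerator (q : K) (v : Fin m → K) (n : ℕ) (p : Fin (n + 1) × Fin m) :
    HeckeAlgebra q v (n + 1) :=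
  cosetElement (tau q v n.succ_pos) (sigmaFamily q v (n + 1)) n p.1 p.2

theorem cosetElement_mem_span {j : ℕ} (hj : j ≤ n) (a : ℕ) :
    cosetElement (tau q v n.succ_pos) (sigmaFamily q v (n + 1)) n j a ∈
      Submodule.span K (Set.range (cosetGenerator q v n)) := by
  set s := sigmaFamily q v (n + 1)
  have h := Submodule.mem_map_of_mem (f := LinearMap.mulLeftRight K (descProd s j, ascProd s n))
    (tau_pow_mem_span (q := q) (v := v) n.succ_pos a)
  rw [Submodule.map_span, ← Set.range_comp] at h
  refine Submodule.span_mono ?_ h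
  rintro _ ⟨i, rfl⟩
  exact ⟨(⟨j, by omega⟩, i), rfl⟩

theorem span_mul_range_inclusion_eq_top :
    Submodule.span K (Set.range (cosetGenerator q v n)) *
      Subalgebra.toSubmodule (inclusion q v n).range = ⊤ := by
  rw [eq_top_iff, ← cosetSpan_inclusion_eq_top, cosetSpan]
  refine mul_le_mul' (Submodule.span_le.2 ?_) le_rfl
  rintro _ ⟨j, hj, a, rfl⟩
  exact cosetElement_mem_span hj a

theorem algebraMap_surjective_zero : Function.Surjective (algebraMap K (HeckeAlgebra q v 0)) := by
  have h : LinearMap.range (Algebra.linearMap K (HeckeAlgebra q v 0)) = ⊤ :=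
    eq_top_of_generators_mul_mem ⟨1, map_one (algebraMap K _)⟩ (fun h => absurd h (by omega))
      (fun i h => absurd h (by omega))
  exact LinearMap.range_eq_top.1 h

instance : Module.Finite K (HeckeAlgebra q v n) := by
  induction n with
  | zero =>
    exact Module.Finite.of_surjective (Algebra.linearMap K (HeckeAlgebra q v 0))
      algebraMap_surjective_zero
  | succ n ih =>
    refine ⟨(span_mul_range_inclusion_eq_top (q := q) (v := v)) ▸ Submodule.FG.mul ?_ ?_⟩
    · exact Submodule.fg_span (Set.finite_range _)
    · exact Module.Finite.iff_fg.1 (Module.Finite.range (inclusion q v n).toLinearMap)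

theorem finrank_le (q : K) (v : Fin m → K) (n : ℕ) :
    Module.finrank K (HeckeAlgebra q v n) ≤ n.factorial * m ^ n := by
  induction n with
  | zero =>
    simpa using LinearMap.finrank_le_finrank_of_surjective
      (f := Algebra.linearMap K (HeckeAlgebra q v 0)) algebraMap_surjective_zero
  | succ n ih =>
    have hW : Module.finrank K (Submodule.span K (Set.range (cosetGenerator q v n))) ≤
        (n + 1) * m := by
      simpa [Set.finrank] using finrank_range_le_card (R := K) (cosetGenerator q v n)
    have hB : Module.finrank K (Subalgebra.toSubmodule (inclusion q v n).range) ≤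
        n.factorial * m ^ n :=
      (LinearMap.finrank_range_le (inclusion q v n).toLinearMap).trans ih
    calc Module.finrank K (HeckeAlgebra q v (n + 1))
        ≤ Module.finrank K (Submodule.span K (Set.range (cosetGenerator q v n))) *
            Module.finrank K (Subalgebra.toSubmodule (inclusion q v n).range) := by
          rw [← finrank_top, ← span_mul_range_inclusion_eq_top]
          exact finrank_submodule_mul_le _ _
      _ ≤ (n + 1) * m * (n.factorial * m ^ n) := Nat.mul_le_mul hW hB
      _ = (n + 1).factorial * m ^ (n + 1) := by rw [Nat.factorial_succ, pow_succ]; ring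

end HeckeAlgebra

end DimensionBound

/-! ### Differential orders -/

section Differential

variable {α : Type*} [PartialOrder α]

open Classical in
/-- The elements which can be removed from a lower set `S` so that it remains a lower set. -/
noncomputable def removable (S : Finset α) : Finset α :=
  {y ∈ S | Maximal (· ∈ S) y}

open Classical in
/-- The elements which can be added to a lower set `S` so that it remains a lower set; the junk
value `∅` is used if there are infinitely many of them. -/
noncomputable def addable (S : Finset α) : Finset α :=
  if h : {x | Minimal (· ∉ S) x}.Finite then h.toFinset else ∅

/-- Every finite lower set has exactly `r` more addable than removable elements. This says that the
lattice of finite lower sets of `α` is `r`-differential in the sense of Stanley. -/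
structure IsDifferential (α : Type*) [PartialOrder α] (r : ℕ) : Prop where
  finite_addable : ∀ {S : Finset α}, IsLowerSet (S : Set α) → {x | Minimal (· ∉ S) x}.Finite
  card_addable : ∀ {S : Finset α}, IsLowerSet (S : Set α) →
    (addable S).card = (removable S).card + r

variable {S : Finset α} {x y : α} {r : ℕ}

theorem mem_removable : y ∈ removable S ↔ Maximal (· ∈ S) y := by
  simpa [removable] using fun h => h.prop

theorem mem_addable_of_finite (h : {x | Minimal (· ∉ S) x}.Finite) :
    x ∈ addable S ↔ Minimal (· ∉ S) x := by
  simp [addable, h]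

open Classical in
/-- The sequences of `n` elements of `S` whose order extends the order of `α`; the elements are
then distinct. -/
noncomputable def linearExtensions (n : ℕ) (S : Finset α) : Finset (Fin n → α) :=
  {p ∈ Fintype.piFinset fun _ => S | ∀ i j, p i ≤ p j → i ≤ j}

theorem mem_linearExtensions {n : ℕ} {p : Fin n → α} :
    p ∈ linearExtensions n S ↔ (∀ i, p i ∈ S) ∧ ∀ i j, p i ≤ p j → i ≤ j := by
  simp [linearExtensions]

variable [DecidableEq α]

theorem card_erase_of_mem_removable {k : ℕ} (hS : S.card = k + 1) (hy : y ∈ removable S) :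
    (S.erase y).card = k := by
  rw [Finset.card_erase_of_mem (mem_removable.1 hy).prop, hS, Nat.add_sub_cancel]

theorem isLowerSet_insert (hS : IsLowerSet (S : Set α)) (hx : Minimal (· ∉ S) x) :
    IsLowerSet ((insert x S : Finset α) : Set α) := by
  intro a b hba ha
  rw [Finset.mem_coe, Finset.mem_insert] at *
  rcases hba.eq_or_lt with rfl | hlt
  · exact ha
  · rcases ha with rfl | ha
    · exact Or.inr (not_not.1 (hx.not_prop_of_lt hlt))
    · exact Or.inr (hS hba ha)

theorem isLowerSet_erase (hS : IsLowerSet (S : Set α)) (hy : y ∈ removable S) :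
    IsLowerSet ((S.erase y : Finset α) : Set α) := by
  intro a b hba ha
  rw [Finset.mem_coe, Finset.mem_erase] at *
  refine ⟨?_, hS hba ha.2⟩
  rintro rfl
  exact (mem_removable.1 hy).not_gt ha.2 (hba.lt_of_ne' ha.1)

open Classical in
theorem removable_insert (hS : IsLowerSet (S : Set α)) (hx : Minimal (· ∉ S) x) :
    removable (insert x S) = insert x {y ∈ removable S | ¬ y < x} := by
  ext y
  simp only [mem_removable, maximal_iff_forall_gt, Finset.mem_insert, Finset.mem_filter, not_or]
  constructor
  · rintro ⟨rfl | hy, h⟩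
    · exact Or.inl rfl
    · exact Or.inr ⟨⟨hy, fun z hz => (h hz).2⟩, fun hyx => (h hyx).1 rfl⟩
  · rintro (rfl | ⟨⟨hy, h⟩, hyx⟩)
    · exact ⟨Or.inl rfl, fun z hz => ⟨hz.ne', fun hzS => hx.prop (hS hz.le hzS)⟩⟩
    · exact ⟨Or.inr hy, fun z hz => ⟨fun e => hyx (e ▸ hz), h hz⟩⟩

theorem mem_removable_insert (hS : IsLowerSet (S : Set α)) (hx : Minimal (· ∉ S) x) :
    x ∈ removable (insert x S) := by
  rw [removable_insert hS hx]
  exact Finset.mem_insert_self _ _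

theorem minimal_notMem_erase_iff (hS : IsLowerSet (S : Set α)) (hy : y ∈ removable S) :
    Minimal (· ∉ S.erase y) x ↔ x = y ∨ Minimal (· ∉ S) x ∧ ¬ y < x := by
  have hyS := (mem_removable.1 hy).prop
  simp only [minimal_iff_forall_lt, Finset.mem_erase, not_not]
  constructor
  · rintro ⟨hx, h⟩
    by_cases hxy : x = y
    · exact Or.inl hxy
    · exact Or.inr ⟨⟨fun hxS => hx ⟨hxy, hxS⟩, fun z hz => (h hz).2⟩, fun hlt => (h hlt).1 rfl⟩
  · rintro (rfl | ⟨⟨hx, h⟩, hyx⟩)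
    · exact ⟨fun h => h.1 rfl, fun z hz => ⟨hz.ne, hS hz.le hyS⟩⟩
    · exact ⟨fun hxS => hx hxS.2, fun z hz => ⟨fun e => hyx (e ▸ hz), h hz⟩⟩

/-- The number of ways to remove `k` elements from the lower set `S` one by one. -/
noncomputable def chainCount : ℕ → Finset α → ℕ
  | 0, _ => 1
  | k + 1, S => ∑ y ∈ removable S, chainCount k (S.erase y)

open Classical in
theorem chainCount_insert (hS : IsLowerSet (S : Set α)) (k : ℕ) (hx : Minimal (· ∉ S) x) :
    chainCount (k + 1) (insert x S) =
      chainCount k S + ∑ y ∈ removable S with ¬ y < x, chainCount k ((insert x S).erase y) := by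
  rw [chainCount, removable_insert hS hx, Finset.sum_insert, Finset.erase_insert hx.prop]
  exact fun h => hx.prop (mem_removable.1 (Finset.mem_filter.1 h).1).prop

namespace IsDifferential

variable (D : IsDifferential α r) (hS : IsLowerSet (S : Set α))
include D hS

omit [DecidableEq α] in
theorem mem_addable : x ∈ addable S ↔ Minimal (· ∉ S) x :=
  mem_addable_of_finite (D.finite_addable hS)

theorem mem_addable_erase (hy : y ∈ removable S) : y ∈ addable (S.erase y) :=
  (D.mem_addable (isLowerSet_erase hS hy)).2 ((minimal_notMem_erase_iff hS hy).2 (Or.inl rfl))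

open Classical in
theorem sum_addable_erase (f : α → ℕ) (hy : y ∈ removable S) :
    ∑ x ∈ addable (S.erase y), f x = f y + ∑ x ∈ addable S with ¬ y < x, f x := by
  have h : addable (S.erase y) = insert y {x ∈ addable S | ¬ y < x} := by
    ext x
    rw [D.mem_addable (isLowerSet_erase hS hy), minimal_notMem_erase_iff hS hy,
      Finset.mem_insert, Finset.mem_filter, D.mem_addable hS]
  have hyS := (mem_removable.1 hy).prop
  rw [h, Finset.sum_insert]
  exact fun hmem => ((D.mem_addable hS).1 (Finset.mem_filter.1 hmem).1).prop hyS

open Classical in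
theorem sum_chainCount_insert_eq_add (k : ℕ) :
    ∑ x ∈ addable S, chainCount (k + 1) (insert x S) = (addable S).card * chainCount k S +
      ∑ y ∈ removable S, ∑ x ∈ addable S with ¬ y < x, chainCount k ((insert x S).erase y) := by
  rw [← smul_eq_mul, ← Finset.sum_const,
    Finset.sum_congr rfl fun x hx => chainCount_insert hS k ((D.mem_addable hS).1 hx),
    Finset.sum_add_distrib]
  simp only [Finset.sum_filter]
  rw [Finset.sum_comm]

open Classical in
theorem sum_chainCount_insert_erase (k : ℕ) (hy : y ∈ removable S) :
    ∑ x ∈ addable (S.erase y), chainCount k (insert x (S.erase y)) =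
      chainCount k S + ∑ x ∈ addable S with ¬ y < x, chainCount k ((insert x S).erase y) := by
  have hyS := (mem_removable.1 hy).prop
  rw [D.sum_addable_erase hS (fun x => chainCount k (insert x (S.erase y))) hy,
    Finset.insert_erase hyS]
  refine congrArg _ (Finset.sum_congr rfl fun x hx => ?_)
  rw [Finset.erase_insert_of_ne]
  rintro rfl
  exact ((D.mem_addable hS).1 (Finset.mem_filter.1 hx).1).prop hyS

/-- The identity `D ∘ U - U ∘ D = r` in Stanley's notation gives `(n + 1) r` by induction. -/
theorem sum_chainCount_insert {k : ℕ} (hk : S.card = k) :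
    ∑ x ∈ addable S, chainCount (k + 1) (insert x S) = r * (k + 1) * chainCount k S := by
  classical
  induction k generalizing S with
  | zero =>
    have hrem : removable S = ∅ := by rw [Finset.card_eq_zero.1 hk]; rfl
    rw [D.sum_chainCount_insert_eq_add hS, D.card_addable hS, hrem]
    simp
  | succ k ih =>
    have herase : ∀ y ∈ removable S, chainCount (k + 1) S +
        ∑ x ∈ addable S with ¬ y < x, chainCount (k + 1) ((insert x S).erase y) =
          r * (k + 1) * chainCount k (S.erase y) := fun y hy => by
      rw [← D.sum_chainCount_insert_erase hS _ hy,
        ih (isLowerSet_erase hS hy) (card_erase_of_mem_removable hk hy)]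
    have hsum := Finset.sum_congr rfl herase
    rw [Finset.sum_add_distrib, Finset.sum_const, smul_eq_mul, ← Finset.mul_sum,
      show ∑ y ∈ removable S, chainCount k (S.erase y) = chainCount (k + 1) S from rfl] at hsum
    rw [D.sum_chainCount_insert_eq_add hS, D.card_addable hS]
    linear_combination hsum

omit hS

theorem sum_chainCount_mul_chainCount_erase {L : ℕ → Finset (Finset α)}
    (hL : ∀ n S, S ∈ L n ↔ IsLowerSet (S : Set α) ∧ S.card = n) (n : ℕ) :
    ∑ T ∈ L (n + 1), ∑ y ∈ removable T, chainCount (n + 1) T * chainCount n (T.erase y) =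
      ∑ S ∈ L n, ∑ x ∈ addable S, chainCount (n + 1) (insert x S) * chainCount n S := by
  rw [Finset.sum_sigma', Finset.sum_sigma']
  refine Finset.sum_bij' (fun p _ => ⟨p.1.erase p.2, p.2⟩) (fun p _ => ⟨insert p.2 p.1, p.2⟩)
    ?_ ?_ ?_ ?_ ?_ <;> rintro ⟨S, z⟩ h <;> rw [Finset.mem_sigma, hL] at h <;>
    obtain ⟨⟨hS, hcard⟩, hz⟩ := h
  · exact Finset.mem_sigma.2 ⟨(hL _ _).2 ⟨isLowerSet_erase hS hz,
      card_erase_of_mem_removable hcard hz⟩, D.mem_addable_erase hS hz⟩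
  · have hz := (D.mem_addable hS).1 hz
    refine Finset.mem_sigma.2 ⟨(hL _ _).2 ⟨isLowerSet_insert hS hz, ?_⟩,
      mem_removable_insert hS hz⟩
    rw [Finset.card_insert_of_notMem hz.prop, hcard]
  · simp only [Finset.insert_erase (mem_removable.1 hz).prop]
  · simp only [Finset.erase_insert ((D.mem_addable hS).1 hz).prop]
  · simp only [Finset.insert_erase (mem_removable.1 hz).prop]

theorem sum_chainCount_sq {L : ℕ → Finset (Finset α)}
    (hL : ∀ n S, S ∈ L n ↔ IsLowerSet (S : Set α) ∧ S.card = n) (n : ℕ) :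
    ∑ S ∈ L n, chainCount n S ^ 2 = n.factorial * r ^ n := by
  induction n with
  | zero =>
    have hL0 : L 0 = {∅} := by
      ext S
      rw [hL, Finset.mem_singleton, Finset.card_eq_zero, and_iff_right_iff_imp]
      rintro rfl
      simp [isLowerSet_empty]
    simp [hL0, chainCount]
  | succ n ih =>
    calc ∑ T ∈ L (n + 1), chainCount (n + 1) T ^ 2
        = ∑ T ∈ L (n + 1), ∑ y ∈ removable T,
            chainCount (n + 1) T * chainCount n (T.erase y) :=
          Finset.sum_congr rfl fun T _ => by rw [← Finset.mul_sum, sq]; rfl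
      _ = ∑ S ∈ L n, ∑ x ∈ addable S, chainCount (n + 1) (insert x S) * chainCount n S :=
          D.sum_chainCount_mul_chainCount_erase hL n
      _ = ∑ S ∈ L n, r * (n + 1) * chainCount n S ^ 2 := by
          refine Finset.sum_congr rfl fun S hS => ?_
          rw [← Finset.sum_mul, D.sum_chainCount_insert ((hL _ _).1 hS).1 ((hL _ _).1 hS).2]
          ring
      _ = (n + 1).factorial * r ^ (n + 1) := by
          rw [← Finset.mul_sum, ih, Nat.factorial_succ]
          ring

end IsDifferential

theorem chainCount_pos {k : ℕ} (hS : S.card = k) : 0 < chainCount k S := by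
  induction k generalizing S with
  | zero => exact Nat.one_pos
  | succ k ih =>
    obtain ⟨y, hy⟩ := S.exists_maximal (Finset.card_pos.1 (by omega))
    exact Finset.sum_pos (fun z hz => ih (card_erase_of_mem_removable hS hz))
      ⟨y, mem_removable.2 hy⟩

theorem snoc_mem_linearExtensions {n : ℕ} {p : Fin n → α} (hy : y ∈ removable S)
    (hp : p ∈ linearExtensions n (S.erase y)) :
    (Fin.snoc p y : Fin (n + 1) → α) ∈ linearExtensions (n + 1) S := by
  rw [mem_linearExtensions] at hp ⊢
  obtain ⟨hmem, hord⟩ := hp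
  have hymax := mem_removable.1 hy
  have hne : ∀ i, p i ≠ y := fun i => Finset.ne_of_mem_erase (hmem i)
  have hpS : ∀ i, p i ∈ S := fun i => Finset.mem_of_mem_erase (hmem i)
  refine ⟨Fin.lastCases (by simpa using hymax.prop) (by simpa using hpS), fun i j => ?_⟩
  cases j using Fin.lastCases with
  | last => exact fun _ => Fin.le_last i
  | cast j =>
    cases i using Fin.lastCases with
    | last => simpa using fun h => hymax.not_gt (hpS j) (lt_of_le_of_ne h (hne j).symm)
    | cast i => simpa using hord i j

theorem chainCount_le_card_linearExtensions (n : ℕ) (S : Finset α) :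
    chainCount n S ≤ (linearExtensions n S).card := by
  induction n generalizing S with
  | zero =>
    rw [chainCount, Nat.succ_le_iff, Finset.card_pos]
    exact ⟨Fin.elim0, mem_linearExtensions.2 ⟨fun i => i.elim0, fun i => i.elim0⟩⟩
  | succ n ih =>
    calc chainCount (n + 1) S
        ≤ ∑ y ∈ removable S, (linearExtensions n (S.erase y)).card :=
          Finset.sum_le_sum fun y _ => ih (S.erase y)
      _ = ((removable S).sigma fun y => linearExtensions n (S.erase y)).card :=
          (Finset.card_sigma _ _).symm
      _ ≤ (linearExtensions (n + 1) S).card := by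
          refine Finset.card_le_card_of_injOn
            (fun z => (Fin.snoc z.2 z.1 : Fin (n + 1) → α)) ?_ ?_
          · rintro ⟨y, p⟩ h
            exact snoc_mem_linearExtensions (Finset.mem_sigma.1 h).1 (Finset.mem_sigma.1 h).2
          · rintro ⟨y, p⟩ - ⟨z, r⟩ - h
            obtain ⟨rfl, rfl⟩ := Fin.snoc_inj.1 h
            rfl

end Differential

section Sigma

variable {ι : Type*} {α : ι → Type*}

/-- The part of a finite subset of a disjoint union which lies in the `i`-th summand. -/
noncomputable def slice (S : Finset (Σ i, α i)) (i : ι) : Finset (α i) :=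
  S.preimage (Sigma.mk i) sigma_mk_injective.injOn

variable {S : Finset (Σ i, α i)} {i : ι} {a : α i}

theorem mem_slice : a ∈ slice S i ↔ ⟨i, a⟩ ∈ S :=
  Finset.mem_preimage

variable [∀ i, PartialOrder (α i)]

theorem isLowerSet_slice (hS : IsLowerSet (S : Set (Σ i, α i))) (i : ι) :
    IsLowerSet (slice S i : Set (α i)) := fun _ _ hba ha =>
  mem_slice.2 (hS (Sigma.mk_le_mk_iff.2 hba) (mem_slice.1 ha))

theorem minimal_notMem_slice_iff :
    Minimal (· ∉ slice S i) a ↔ Minimal (· ∉ S) (⟨i, a⟩ : Σ i, α i) := by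
  simp only [Minimal, mem_slice, Sigma.forall, and_congr_right_iff]
  refine fun _ => ⟨?_, fun h b hb hba => Sigma.mk_le_mk_iff.1 (h i b hb (Sigma.mk_le_mk_iff.2 hba))⟩
  rintro h j b hb ⟨_, _, _, hba⟩
  exact Sigma.mk_le_mk_iff.2 (h hb hba)

theorem maximal_mem_slice_iff :
    Maximal (· ∈ slice S i) a ↔ Maximal (· ∈ S) (⟨i, a⟩ : Σ i, α i) := by
  simp only [Maximal, mem_slice, Sigma.forall, and_congr_right_iff]
  refine fun _ => ⟨?_, fun h b hb hab => Sigma.mk_le_mk_iff.1 (h i b hb (Sigma.mk_le_mk_iff.2 hab))⟩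
  rintro h j b hb ⟨_, _, _, hab⟩
  exact Sigma.mk_le_mk_iff.2 (h hb hab)

theorem IsDifferential.sigma [Fintype ι] {r : ι → ℕ} (D : ∀ i, IsDifferential (α i) (r i)) :
    IsDifferential (Σ i, α i) (∑ i, r i) := by
  have hmem : ∀ {S : Finset (Σ i, α i)}, IsLowerSet (S : Set (Σ i, α i)) → ∀ x,
      x ∈ Finset.univ.sigma (fun i => addable (slice S i)) ↔ Minimal (· ∉ S) x :=
    fun hS ⟨i, a⟩ => by
      simp [(D i).mem_addable (isLowerSet_slice hS i), minimal_notMem_slice_iff]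
  have hfin : ∀ {S : Finset (Σ i, α i)}, IsLowerSet (S : Set (Σ i, α i)) →
      {x | Minimal (· ∉ S) x}.Finite := fun hS =>
    (Finset.finite_toSet _).subset fun x hx => (hmem hS x).2 hx
  refine ⟨hfin, fun {S} hS => ?_⟩
  have hadd : addable S = Finset.univ.sigma fun i => addable (slice S i) := by
    ext x
    rw [hmem hS, mem_addable_of_finite (hfin hS)]
  have hrem : removable S = Finset.univ.sigma fun i => removable (slice S i) := by
    ext ⟨i, a⟩
    simp [mem_removable, maximal_mem_slice_iff]
  simp only [hadd, hrem, Finset.card_sigma, (D _).card_addable (isLowerSet_slice hS _),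
    Finset.sum_add_distrib]

end Sigma

section NatProdNat

variable (μ : YoungDiagram)

theorem minimal_notMem_youngDiagram_iff {x : ℕ × ℕ} :
    Minimal (· ∉ μ) x ↔ x = (0, μ.rowLen 0) ∨
      ∃ r, μ.rowLen (r + 1) < μ.rowLen r ∧ x = (r + 1, μ.rowLen (r + 1)) := by
  simp only [minimal_iff_forall_lt, not_not, Prod.forall, Prod.lt_iff]
  obtain ⟨r, s⟩ := x
  simp only [YoungDiagram.mem_iff_lt_rowLen, Prod.mk.injEq]
  constructor
  · rintro ⟨hx, h⟩
    have hs : s = μ.rowLen r := by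
      by_contra hne
      have := h r (s - 1) (by omega)
      omega
    cases r with
    | zero => exact Or.inl ⟨rfl, hs⟩
    | succ r => exact Or.inr ⟨r, hs ▸ h r s (by omega), rfl, hs⟩
  · rintro (⟨rfl, rfl⟩ | ⟨r, hr, rfl, rfl⟩)
    · refine ⟨lt_irrefl _, fun a b hab => ?_⟩
      obtain rfl : a = 0 := by omega
      omega
    · refine ⟨lt_irrefl _, fun a b hab => ?_⟩
      rcases Nat.lt_or_ge r a with ha | ha
      · obtain rfl : a = r + 1 := by omega
        omega
      · have := μ.rowLen_anti a r ha
        omega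

theorem maximal_mem_youngDiagram_iff {x : ℕ × ℕ} :
    Maximal (· ∈ μ) x ↔ x.2 + 1 = μ.rowLen x.1 ∧ μ.rowLen (x.1 + 1) < μ.rowLen x.1 := by
  simp only [maximal_iff_forall_gt, Prod.forall, Prod.lt_iff]
  obtain ⟨r, s⟩ := x
  simp only [YoungDiagram.mem_iff_lt_rowLen]
  constructor
  · rintro ⟨hx, h⟩
    have hright := h r (s + 1) (by omega)
    have hbelow := h (r + 1) s (by omega)
    omega
  · rintro ⟨hs, hr⟩
    refine ⟨by omega, fun a b hab => ?_⟩
    rcases hab with ⟨ha, hb⟩ | ⟨ha, hb⟩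
    · have := μ.rowLen_anti (r + 1) a ha
      omega
    · have := μ.rowLen_anti r a ha
      omega

theorem isDifferential_nat_prod_nat : IsDifferential (ℕ × ℕ) 1 := by
  classical
  have hset : ∀ {S : Finset (ℕ × ℕ)} (hS : IsLowerSet (S : Set (ℕ × ℕ))),
      let μ : YoungDiagram := ⟨S, hS⟩
      ∀ x, Minimal (· ∉ S) x ↔ x ∈ insert (0, μ.rowLen 0)
        ((removable S).image fun y => (y.1 + 1, μ.rowLen (y.1 + 1))) := by
    intro S hS μ x
    refine (minimal_notMem_youngDiagram_iff μ).trans ?_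
    simp only [Finset.mem_insert, Finset.mem_image, mem_removable]
    refine or_congr_right ⟨?_, ?_⟩
    · rintro ⟨r, hr, rfl⟩
      exact ⟨(r, μ.rowLen r - 1),
        (maximal_mem_youngDiagram_iff μ).2 ⟨Nat.sub_add_cancel (by omega), hr⟩, rfl⟩
    · rintro ⟨y, hy, rfl⟩
      exact ⟨y.1, ((maximal_mem_youngDiagram_iff μ).1 hy).2, rfl⟩
  have hfin : ∀ {S : Finset (ℕ × ℕ)}, IsLowerSet (S : Set (ℕ × ℕ)) →
      {x | Minimal (· ∉ S) x}.Finite := fun hS =>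
    (Finset.finite_toSet _).subset fun x hx => (hset hS x).1 hx
  refine ⟨hfin, fun {S} hS => ?_⟩
  have hadd := Finset.ext fun x =>
    (mem_addable_of_finite (hfin hS) (x := x)).trans (hset hS x)
  rw [hadd, Finset.card_insert_of_notMem (by simp), Finset.card_image_of_injOn]
  intro y hy z hz hyz
  have hy := ((maximal_mem_youngDiagram_iff ⟨S, hS⟩).1 (mem_removable.1 hy)).1
  have hz := ((maximal_mem_youngDiagram_iff ⟨S, hS⟩).1 (mem_removable.1 hz)).1
  have hrow : y.1 = z.1 := Nat.succ_injective (Prod.mk.inj hyz).1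
  rw [hrow, ← hz] at hy
  exact Prod.ext hrow (Nat.succ_injective hy)

end NatProdNat

/-! ### Positions of the entries of a tableau -/

/-- Possible nodes of `m`-tuples of diagrams: `⟨k, (r, s)⟩` is the node in line `r` and column `s`
of the `k`-th diagram. In the order used, nodes of different diagrams are incomparable. -/
abbrev Cell (m : ℕ) : Type := Σ _ : Fin m, ℕ × ℕ

section Cells

variable {m n : ℕ}

theorem isDifferential_cell (m : ℕ) : IsDifferential (Cell m) m := by
  simpa using IsDifferential.sigma fun _ : Fin m => isDifferential_nat_prod_nat

namespace Cell

variable {x y : Cell m}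

theorem le_iff : x ≤ y ↔ x.1 = y.1 ∧ x.2.1 ≤ y.2.1 ∧ x.2.2 ≤ y.2.2 := by
  constructor
  · rintro ⟨_, _, _, hab⟩
    exact ⟨rfl, hab.1, hab.2⟩
  · obtain ⟨k, a⟩ := x
    obtain ⟨l, b⟩ := y
    rintro ⟨rfl : k = l, hab⟩
    exact Sigma.mk_le_mk_iff.2 hab

theorem lt_iff : x < y ↔ x.1 = y.1 ∧ x.2.1 ≤ y.2.1 ∧ x.2.2 ≤ y.2.2 ∧
    x.2.1 + x.2.2 < y.2.1 + y.2.2 := by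
  rw [lt_iff_le_not_ge, le_iff, le_iff]
  omega

/-- The number of the diagonal of a node, on which its content depends. -/
def diagonal (x : Cell m) : ℤ := (x.2.2 : ℤ) - x.2.1

theorem le_total_of_diagonal (h : x.1 = y.1) (hxy : x.diagonal ≤ y.diagonal + 1)
    (hyx : y.diagonal ≤ x.diagonal + 1) : x ≤ y ∨ y ≤ x := by
  rw [diagonal, diagonal] at hxy hyx
  rw [le_iff, le_iff]
  omega

theorem diagonal_of_covBy (h : x ⋖ y) :
    x.1 = y.1 ∧ (y.diagonal = x.diagonal + 1 ∨ x.diagonal = y.diagonal + 1) := by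
  obtain ⟨hk, hr, hs, hlt⟩ := lt_iff.1 h.lt
  have hright := h.2 (c := ⟨x.1, (x.2.1, x.2.2 + 1)⟩) (lt_iff.2 ⟨rfl, by simp⟩)
  have hbelow := h.2 (c := ⟨x.1, (x.2.1 + 1, x.2.2)⟩) (lt_iff.2 ⟨rfl, by simp⟩)
  simp only [lt_iff, diagonal] at hright hbelow ⊢
  omega

variable {S : Finset (Cell m)}

theorem lt_card_row (hS : IsLowerSet (S : Set (Cell m))) (hx : x ∈ S) :
    x.2.2 < {z ∈ S | z.1 = x.1 ∧ z.2.1 = 0}.card := by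
  rw [← Nat.add_one_le_iff, ← Finset.card_range (x.2.2 + 1)]
  refine Finset.card_le_card_of_injOn (fun j => ⟨x.1, (0, j)⟩) (fun j hj => ?_) fun i _ j _ h => ?_
  · have hle : (⟨x.1, (0, j)⟩ : Cell m) ≤ x :=
      le_iff.2 ⟨rfl, Nat.zero_le _, Nat.lt_succ_iff.1 (Finset.mem_range.1 hj)⟩
    exact Finset.mem_filter.2 ⟨hS hle hx, rfl, rfl⟩
  · exact congrArg (fun z : Cell m => z.2.2) h

theorem lt_card_column (hS : IsLowerSet (S : Set (Cell m))) (hx : x ∈ S) :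
    x.2.1 < {z ∈ S | z.1 = x.1 ∧ z.2.2 = 0}.card := by
  rw [← Nat.add_one_le_iff, ← Finset.card_range (x.2.1 + 1)]
  refine Finset.card_le_card_of_injOn (fun i => ⟨x.1, (i, 0)⟩) (fun i hi => ?_) fun i _ j _ h => ?_
  · have hle : (⟨x.1, (i, 0)⟩ : Cell m) ≤ x :=
      le_iff.2 ⟨rfl, Nat.lt_succ_iff.1 (Finset.mem_range.1 hi), Nat.zero_le _⟩
    exact Finset.mem_filter.2 ⟨hS hle hx, rfl, rfl⟩
  · exact congrArg (fun z : Cell m => z.2.1) h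

theorem diagonal_sub_diagonal_add_two_le (hS : IsLowerSet (S : Set (Cell m))) (hx : x ∈ S)
    (hy : y ∈ S) :
    x.diagonal - y.diagonal + 2 ≤ S.card + if x.1 = y.1 then 1 else 0 := by
  have hrow := lt_card_row hS hx
  have hcolumn := lt_card_column hS hy
  set R := {z ∈ S | z.1 = x.1 ∧ z.2.1 = 0}
  set C := {z ∈ S | z.1 = y.1 ∧ z.2.2 = 0}
  have hunion : (R ∪ C).card ≤ S.card :=
    Finset.card_le_card (Finset.union_subset (Finset.filter_subset _ _) (Finset.filter_subset _ _))
  have hinter : (R ∩ C).card ≤ if x.1 = y.1 then 1 else 0 := by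
    split_ifs with h
    · refine Finset.card_le_one.2 fun a ha b hb => le_antisymm ?_ ?_ <;>
        simp only [R, C, Finset.mem_inter, Finset.mem_filter] at ha hb <;> rw [le_iff] <;> omega
    · rw [Nat.le_zero, Finset.card_eq_zero, ← Finset.disjoint_iff_inter_eq_empty]
      exact Finset.disjoint_filter.2 fun z _ hx hy => h (hx.1.symm.trans hy.1)
  have hcard := Finset.card_union_add_card_inter R C
  rw [diagonal, diagonal]
  split_ifs at hinter ⊢ <;> omega

end Cell

/-- The set of nodes of an `m`-partition. -/
def cellsOf (lam : MultiPartition m n) : Finset (Cell m) :=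
  Finset.univ.sigma fun k => (lam.diagram k).cells

theorem mem_cellsOf {lam : MultiPartition m n} {x : Cell m} :
    x ∈ cellsOf lam ↔ x.2 ∈ lam.diagram x.1 := by
  simp [cellsOf]

theorem card_cellsOf (lam : MultiPartition m n) : (cellsOf lam).card = n :=
  (Finset.card_sigma _ _).trans lam.sum_card

theorem isLowerSet_cellsOf (lam : MultiPartition m n) :
    IsLowerSet (cellsOf lam : Set (Cell m)) := by
  rintro _ _ ⟨k, a, b, hab⟩ h
  exact mem_cellsOf.2 ((lam.diagram k).isLowerSet hab (mem_cellsOf.1 h))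

theorem cellsOf_injective :
    Function.Injective (cellsOf : MultiPartition m n → Finset (Cell m)) := by
  intro lam mu h
  refine MultiPartition.ext (funext fun k => YoungDiagram.ext (Finset.ext fun c => ?_))
  simpa [mem_cellsOf] using Finset.ext_iff.1 h ⟨k, c⟩

theorem exists_cellsOf_eq {S : Finset (Cell m)} (hS : IsLowerSet (S : Set (Cell m)))
    (hcard : S.card = n) : ∃ lam : MultiPartition m n, cellsOf lam = S := by
  have hcells : (Finset.univ.sigma fun k => slice S k) = S := by
    ext x
    simp [mem_slice]
  exact ⟨⟨fun k => ⟨slice S k, isLowerSet_slice hS k⟩,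
    by rw [← hcard, ← congrArg Finset.card hcells, Finset.card_sigma]⟩, hcells⟩

variable {lam : MultiPartition m n}

/-- The position of a node, without reference to the shape containing it. -/
def nodeCell (x : Node lam) : Cell m := ⟨x.1, x.2.1⟩

theorem nodeCell_mem (x : Node lam) : nodeCell x ∈ cellsOf lam :=
  mem_cellsOf.2 x.2.2

theorem nodeCell_injective : Function.Injective (nodeCell : Node lam → Cell m) := by
  rintro ⟨k, a, ha⟩ ⟨l, b, hb⟩ h
  obtain ⟨rfl, rfl⟩ : k = l ∧ a = b := by simpa [nodeCell] using h
  rfl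

theorem isStandard_iff_nodeCell (e : Node lam ≃ Fin n) :
    IsStandard lam e ↔ ∀ x y, nodeCell x ≤ nodeCell y → e x ≤ e y := by
  constructor
  · rintro ⟨hrow, hcol⟩ ⟨k, ⟨r, s⟩, hx⟩ ⟨l, ⟨r', s'⟩, hy⟩ hxy
    obtain ⟨rfl : k = l, hr : r ≤ r', hs : s ≤ s'⟩ := Cell.le_iff.1 hxy
    have hz : (r, s') ∈ lam.diagram k := (lam.diagram k).up_left_mem hr le_rfl hy
    calc e ⟨k, (r, s), hx⟩ ≤ e ⟨k, (r, s'), hz⟩ := by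
          rcases hs.lt_or_eq with hs | rfl
          exacts [(hrow k r s s' hx hz hs).le, le_rfl]
      _ ≤ e ⟨k, (r', s'), hy⟩ := by
          rcases hr.lt_or_eq with hr | rfl
          exacts [(hcol k r r' s' hz hy hr).le, le_rfl]
  · intro h
    have hlt : ∀ {x y}, nodeCell x < nodeCell y → e x < e y := fun {x y} hxy =>
      lt_of_le_of_ne (h x y hxy.le) (e.injective.ne (ne_of_apply_ne nodeCell hxy.ne))
    refine ⟨fun k r s s' _ _ hs => hlt (Cell.lt_iff.2 ⟨rfl, ?_⟩),
      fun k r r' s _ _ hr => hlt (Cell.lt_iff.2 ⟨rfl, ?_⟩)⟩ <;>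
    · simp only [nodeCell]
      omega

theorem isStandard_iff (e : Node lam ≃ Fin n) :
    IsStandard lam e ↔ ∀ i j, nodeCell (e.symm i) ≤ nodeCell (e.symm j) → i ≤ j := by
  rw [isStandard_iff_nodeCell, e.surjective.forall₂]
  simp only [Equiv.symm_apply_apply]

theorem eq_of_swap_le_swap {i : ℕ} (h : i + 1 < n) {a b : Fin n} (hba : b < a)
    (hab : Equiv.swap ⟨i, by omega⟩ ⟨i + 1, h⟩ a ≤ Equiv.swap ⟨i, by omega⟩ ⟨i + 1, h⟩ b) :
    a = ⟨i + 1, h⟩ ∧ b = ⟨i, by omega⟩ := by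
  simp only [Equiv.swap_apply_def, Fin.ext_iff] at hab ⊢
  split_ifs at hab <;> simp only [Fin.le_def, Fin.lt_def] at * <;> omega

namespace StandardTableau

/-- The position of the entry `i` in a standard tableau. -/
def pos (X : StandardTableau lam) (i : Fin n) : Cell m := nodeCell (X.entry.symm i)

theorem pos_mem (X : StandardTableau lam) (i : Fin n) : X.pos i ∈ cellsOf lam :=
  nodeCell_mem _

theorem pos_injective (X : StandardTableau lam) : Function.Injective X.pos :=
  nodeCell_injective.comp X.entry.symm.injective

theorem range_pos (X : StandardTableau lam) : Set.range X.pos = cellsOf lam := by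
  refine Set.Subset.antisymm (Set.range_subset_iff.2 X.pos_mem) fun x hx => ?_
  exact ⟨X.entry ⟨x.1, x.2, mem_cellsOf.1 hx⟩, congrArg nodeCell (X.entry.symm_apply_apply _)⟩

theorem exists_pos_eq (X : StandardTableau lam) {x : Cell m} (hx : x ∈ cellsOf lam) :
    ∃ i, X.pos i = x :=
  X.range_pos.ge hx

theorem le_of_pos_le (X : StandardTableau lam) {i j : Fin n} (h : X.pos i ≤ X.pos j) : i ≤ j :=
  (isStandard_iff _).1 X.standard i j h

theorem lt_of_pos_lt (X : StandardTableau lam) {i j : Fin n} (h : X.pos i < X.pos j) : i < j :=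
  lt_of_le_of_ne (X.le_of_pos_le h.le) (ne_of_apply_ne X.pos h.ne)

theorem exists_pos_eq_of_le (X : StandardTableau lam) {x : Cell m} {j : Fin n}
    (hx : x ≤ X.pos j) : ∃ i ≤ j, X.pos i = x := by
  obtain ⟨i, rfl⟩ := X.exists_pos_eq (isLowerSet_cellsOf lam hx (X.pos_mem j))
  exact ⟨i, X.le_of_pos_le hx, rfl⟩

theorem eq_of_pos_eq {X Y : StandardTableau lam} (h : X.pos = Y.pos) : X = Y :=
  StandardTableau.ext (Equiv.symm_bijective.injective
    (Equiv.ext fun i => nodeCell_injective (congrFun h i)))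

theorem sigma_mk_eq_of_pos_eq {mu : MultiPartition m n} {X : StandardTableau lam}
    {Y : StandardTableau mu} (h : X.pos = Y.pos) :
    (⟨lam, X⟩ : Σ nu : MultiPartition m n, StandardTableau nu) = ⟨mu, Y⟩ := by
  obtain rfl : lam = mu := cellsOf_injective <| Finset.coe_injective <| by
    rw [← X.range_pos, ← Y.range_pos, h]
  rw [eq_of_pos_eq h]

theorem exists_pos_eq_of_mem_linearExtensions {p : Fin n → Cell m}
    (hp : p ∈ linearExtensions n (cellsOf lam)) : ∃ X : StandardTableau lam, X.pos = p := by
  obtain ⟨hmem, hord⟩ := mem_linearExtensions.1 hp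
  have hinj : Function.Injective p := fun i j h => le_antisymm (hord i j h.le) (hord j i h.ge)
  have hsurj := Finset.surjOn_of_injOn_of_card_le p (s := Finset.univ) (t := cellsOf lam)
    (fun i _ => hmem i) hinj.injOn (by rw [card_cellsOf, Finset.card_fin])
  let node : Fin n → Node lam := fun i => ⟨(p i).1, (p i).2, mem_cellsOf.1 (hmem i)⟩
  have hnode : Function.Bijective node := by
    refine ⟨fun i j h => hinj (congrArg nodeCell h), fun x => ?_⟩
    obtain ⟨i, -, hi⟩ := hsurj (nodeCell_mem x)
    exact ⟨i, nodeCell_injective hi⟩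
  exact ⟨⟨(Equiv.ofBijective node hnode).symm, (isStandard_iff _).2 hord⟩, rfl⟩

instance (lam : MultiPartition m n) : Finite (StandardTableau lam) :=
  Finite.of_injective (fun X i => (⟨X.pos i, X.pos_mem i⟩ : cellsOf lam)) fun _ _ h =>
    eq_of_pos_eq (funext fun i => congrArg Subtype.val (congrFun h i))

noncomputable instance (lam : MultiPartition m n) : Fintype (StandardTableau lam) :=
  Fintype.ofFinite _

theorem swap_isStandard_iff (X : StandardTableau lam) {i : ℕ} (h : i + 1 < n) :
    IsStandard lam (X.entry.trans (Equiv.swap ⟨i, by omega⟩ ⟨i + 1, h⟩)) ↔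
      ¬ X.pos ⟨i, by omega⟩ < X.pos ⟨i + 1, h⟩ := by
  rw [isStandard_iff, Equiv.symm_trans, Equiv.symm_swap]
  change (∀ a b, X.pos (Equiv.swap _ _ a) ≤ X.pos (Equiv.swap _ _ b) → a ≤ b) ↔ _
  constructor
  · intro hs hlt
    have := hs ⟨i + 1, h⟩ ⟨i, by omega⟩ (by simpa using hlt.le)
    simp at this
  · intro hn a b hab
    by_contra! hba
    obtain ⟨ha, hb⟩ := eq_of_swap_le_swap h hba (X.le_of_pos_le hab)
    rw [ha, hb, Equiv.swap_apply_left, Equiv.swap_apply_right] at hab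
    exact hn (lt_of_le_of_ne hab (X.pos_injective.ne (by simp)))

theorem exists_pos_eq_comp_swap (X : StandardTableau lam) {i : ℕ} (h : i + 1 < n)
    (hX : ¬ X.pos ⟨i, by omega⟩ < X.pos ⟨i + 1, h⟩) :
    ∃ Y : StandardTableau lam, Y.pos = X.pos ∘ Equiv.swap ⟨i, by omega⟩ ⟨i + 1, h⟩ :=
  ⟨⟨_, (X.swap_isStandard_iff h).2 hX⟩, rfl⟩

theorem pos_lt_of_le_or_le (X : StandardTableau lam) {i j : Fin n} (hij : i < j)
    (h : X.pos i ≤ X.pos j ∨ X.pos j ≤ X.pos i) : X.pos i < X.pos j :=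
  lt_of_le_of_ne (h.resolve_right fun hji => (X.le_of_pos_le hji).not_gt hij)
    (X.pos_injective.ne hij.ne)

theorem pos_covBy_pos (X : StandardTableau lam) {i : ℕ} (h : i + 1 < n)
    (hlt : X.pos ⟨i, by omega⟩ < X.pos ⟨i + 1, h⟩) :
    X.pos ⟨i, by omega⟩ ⋖ X.pos ⟨i + 1, h⟩ := by
  refine ⟨hlt, fun z hz hz' => ?_⟩
  obtain ⟨l, -, rfl⟩ := X.exists_pos_eq_of_le hz'.le
  have := X.lt_of_pos_lt hz
  have := X.lt_of_pos_lt hz'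
  simp only [Fin.lt_def] at *
  omega

theorem add_three_le_of_diagonal_eq (X : StandardTableau lam) {i j : Fin n} (hij : i < j)
    (h : (X.pos i).1 = (X.pos j).1) (hd : (X.pos i).diagonal = (X.pos j).diagonal) :
    i.1 + 3 ≤ j.1 := by
  have hlt := X.pos_lt_of_le_or_le hij (Cell.le_total_of_diagonal h (by omega) (by omega))
  have between : ∀ z, X.pos i < z → z < X.pos j → ∃ l, X.pos l = z ∧ i < l ∧ l < j := by
    intro z hiz hzj
    obtain ⟨l, -, rfl⟩ := X.exists_pos_eq_of_le hzj.le
    exact ⟨l, rfl, X.lt_of_pos_lt hiz, X.lt_of_pos_lt hzj⟩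
  rw [Cell.lt_iff] at hlt
  simp only [Cell.diagonal] at hd
  obtain ⟨a, ha, hia, haj⟩ := between ⟨(X.pos i).1, ((X.pos i).2.1 + 1, (X.pos i).2.2)⟩
    (Cell.lt_iff.2 ⟨rfl, by dsimp only; omega⟩) (Cell.lt_iff.2 ⟨h, by dsimp only; omega⟩)
  obtain ⟨b, hb, hib, hbj⟩ := between ⟨(X.pos i).1, ((X.pos i).2.1, (X.pos i).2.2 + 1)⟩
    (Cell.lt_iff.2 ⟨rfl, by dsimp only; omega⟩) (Cell.lt_iff.2 ⟨h, by dsimp only; omega⟩)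
  have hab : a ≠ b := by
    rintro rfl
    simp [ha] at hb
  omega

theorem minimal_pos (X : StandardTableau lam) (i : Fin n) :
    Minimal (· ∉ (Finset.Iio i).image X.pos) (X.pos i) := by
  simp only [minimal_iff_forall_lt, Finset.mem_image, Finset.mem_Iio, not_not]
  refine ⟨fun ⟨j, hji, hj⟩ => hji.ne (X.pos_injective hj), fun z hz => ?_⟩
  obtain ⟨j, -, rfl⟩ := X.exists_pos_eq_of_le hz.le
  exact ⟨j, X.lt_of_pos_lt hz, rfl⟩

theorem pos_zero (X : StandardTableau lam) (h : 0 < n) : (X.pos ⟨0, h⟩).2 = (0, 0) := by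
  obtain ⟨i, hi, hpos⟩ := X.exists_pos_eq_of_le (x := ⟨(X.pos ⟨0, h⟩).1, (0, 0)⟩)
    (Cell.le_iff.2 ⟨rfl, Nat.zero_le _, Nat.zero_le _⟩)
  obtain rfl : i = ⟨0, h⟩ := Fin.ext (Nat.le_zero.1 hi)
  rw [hpos]

theorem isLowerSet_image_pos (X : StandardTableau lam) (i : Fin n) :
    IsLowerSet ((Finset.Iio i).image X.pos : Set (Cell m)) := by
  rw [Finset.coe_image, Finset.coe_Iio]
  rintro _ y hyx ⟨j, hj, rfl⟩
  obtain ⟨l, hl, rfl⟩ := X.exists_pos_eq_of_le hyx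
  exact ⟨l, hl.trans_lt hj, rfl⟩

end StandardTableau

end Cells

theorem comp_swap_comp_swap {ι κ : Type*} [DecidableEq ι] (a b : ι) (p : ι → κ) :
    (p ∘ Equiv.swap a b) ∘ Equiv.swap a b = p := by
  rw [Function.comp_assoc, ← Equiv.coe_trans, ← Equiv.Perm.mul_def, Equiv.swap_mul_self,
    Equiv.Perm.coe_one, Function.comp_id]

section Tableaux

variable {m n : ℕ}

theorem chainCount_cellsOf_le (lam : MultiPartition m n) :
    chainCount n (cellsOf lam) ≤ Fintype.card (StandardTableau lam) := by
  refine (chainCount_le_card_linearExtensions n _).trans ?_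
  rw [← Fintype.card_coe]
  refine Fintype.card_le_of_surjective (fun X : StandardTableau lam => ⟨X.pos,
    mem_linearExtensions.2 ⟨X.pos_mem, fun _ _ => X.le_of_pos_le⟩⟩) fun p => ?_
  obtain ⟨X, hX⟩ := StandardTableau.exists_pos_eq_of_mem_linearExtensions p.2
  exact ⟨X, Subtype.ext hX⟩

instance (lam : MultiPartition m n) : Nonempty (StandardTableau lam) :=
  Fintype.card_pos_iff.1 <|
    (chainCount_pos (card_cellsOf lam)).trans_le (chainCount_cellsOf_le lam)

theorem factorial_mul_pow_le_sum_card_sq (m n : ℕ) :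
    n.factorial * m ^ n ≤
      ∑ lam : MultiPartition m n, Fintype.card (StandardTableau lam) ^ 2 := by
  let shapes (n : ℕ) : Finset (Finset (Cell m)) :=
    (Finset.univ : Finset (MultiPartition m n)).map ⟨cellsOf, cellsOf_injective⟩
  have mem_shapes (n S) : S ∈ shapes n ↔ IsLowerSet (S : Set (Cell m)) ∧ S.card = n := by
    simp only [shapes, Finset.mem_map, Finset.mem_univ, true_and, Function.Embedding.coeFn_mk]
    constructor
    · rintro ⟨lam, rfl⟩
      exact ⟨isLowerSet_cellsOf lam, card_cellsOf lam⟩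
    · exact fun h => exists_cellsOf_eq h.1 h.2
  calc n.factorial * m ^ n = ∑ S ∈ shapes n, chainCount n S ^ 2 :=
        ((isDifferential_cell m).sum_chainCount_sq mem_shapes n).symm
    _ = ∑ lam : MultiPartition m n, chainCount n (cellsOf lam) ^ 2 := Finset.sum_map _ _ _
    _ ≤ _ := Finset.sum_le_sum fun lam _ => Nat.pow_le_pow_left (chainCount_cellsOf_le lam) 2

namespace StandardTableau

variable {lam : MultiPartition m n}

theorem toLinearExtension_lt {α : Type*} [PartialOrder α] {x y : α} (h : x < y) :
    toLinearExtension x < toLinearExtension y :=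
  lt_of_le_of_ne (toLinearExtension.monotone h.le) h.ne

-- A tableau whose sequence of positions is lexicographically least cannot be improved by exchanging
-- two adjacent entries, so this sequence is increasing.
theorem exists_sorted {C : StandardTableau lam → Prop}
    (hC : ∀ (X Y : StandardTableau lam) (i : ℕ) (h : i + 1 < n),
      Y.pos = X.pos ∘ Equiv.swap ⟨i, by omega⟩ ⟨i + 1, h⟩ → C X → C Y)
    (hne : ∃ X, C X) :
    ∃ Z, C Z ∧ StrictMono fun i => toLinearExtension (Z.pos i) := by
  obtain ⟨Z, hZ, hmin⟩ := Set.exists_min_image {X | C X}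
    (fun X => toLex fun i => toLinearExtension (X.pos i)) (Set.toFinite _) hne
  refine ⟨Z, hZ, ?_⟩
  have hstep (i : ℕ) (h : i + 1 < n) :
      toLinearExtension (Z.pos ⟨i, by omega⟩) < toLinearExtension (Z.pos ⟨i + 1, h⟩) := by
    by_contra hlt
    obtain ⟨Y, hY⟩ := Z.exists_pos_eq_comp_swap h (mt toLinearExtension_lt hlt)
    refine absurd (hmin Y (hC Z Y i h hY hZ)) (not_le.2 ⟨⟨i, by omega⟩, fun j hj => ?_, ?_⟩)
    · change toLinearExtension (Y.pos j) = toLinearExtension (Z.pos j)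
      rw [hY, Function.comp_apply,
        Equiv.swap_apply_of_ne_of_ne hj.ne (hj.trans (Nat.lt_succ_self i)).ne]
    · change toLinearExtension (Y.pos ⟨i, by omega⟩) < toLinearExtension (Z.pos ⟨i, by omega⟩)
      rw [hY, Function.comp_apply, Equiv.swap_apply_left]
      have hne : Z.pos ⟨i + 1, h⟩ ≠ Z.pos ⟨i, by omega⟩ := Z.pos_injective.ne (by simp)
      exact lt_of_le_of_ne (not_lt.1 hlt) hne
  cases n with
  | zero => exact fun i => i.elim0
  | succ n => exact Fin.strictMono_iff_lt_succ.2 fun i => hstep i.1 (by omega)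

theorem eq_of_sorted {X Y : StandardTableau lam}
    (hX : StrictMono fun i => toLinearExtension (X.pos i))
    (hY : StrictMono fun i => toLinearExtension (Y.pos i)) : X = Y :=
  eq_of_pos_eq ((StrictMono.range_inj hX hY).1 (X.range_pos.trans Y.range_pos.symm))

theorem swap_induction {C : StandardTableau lam → Prop}
    (hC : ∀ (X Y : StandardTableau lam) (i : ℕ) (h : i + 1 < n),
      Y.pos = X.pos ∘ Equiv.swap ⟨i, by omega⟩ ⟨i + 1, h⟩ → C X → C Y)
    {X : StandardTableau lam} (hX : C X) (Y : StandardTableau lam) : C Y := by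
  by_contra hY
  obtain ⟨Z, hZ, hsorted⟩ := exists_sorted hC ⟨X, hX⟩
  obtain ⟨Z', hZ', hsorted'⟩ := exists_sorted (C := fun X => ¬ C X)
    (fun X Y i h hXY => mt (hC Y X i h (by rw [hXY, comp_swap_comp_swap]))) ⟨Y, hY⟩
  exact hZ' (eq_of_sorted hsorted hsorted' ▸ hZ)

end StandardTableau

end Tableaux

/-! ### Contents -/

section Contents

variable {K : Type*} [Field K] {m n : ℕ} {q : K} {v : Fin m → K}

/-- The content of a node of an `m`-tuple of diagrams, without reference to a shape. -/
def cellContent (q : K) (v : Fin m → K) (x : Cell m) : K := v x.1 * q ^ (2 * x.diagonal)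

theorem content_eq_cellContent {lam : MultiPartition m n} (X : StandardTableau lam) (i : Fin n) :
    content q v X i = cellContent q v (X.pos i) := rfl

namespace SemisimpleParameters

theorem zpow_ne_one (P : SemisimpleParameters q v n) (hn : 2 ≤ n) {d : ℤ}
    (hd : d ≠ 0) (hle : d.natAbs ≤ n) : q ^ (2 * d) ≠ 1 := by
  have hpow (N : ℕ) (hN : N < n) : (q ^ 2) ^ (N + 1) ≠ 1 := by
    intro h
    have hgeom := geom_sum_mul (q ^ 2) (N + 1)
    rw [h, sub_self, mul_eq_zero, sub_eq_zero] at hgeom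
    refine hgeom.elim (fun hsum => P.qsum_ne_zero N hN ?_) (P.q_sq_ne_one hn)
    simpa only [← pow_mul] using hsum
  obtain ⟨N, hN⟩ : ∃ N, d.natAbs = N + 1 :=
    Nat.exists_eq_succ_of_ne_zero (Int.natAbs_ne_zero.2 hd)
  intro h
  rw [zpow_mul, zpow_ofNat] at h
  have hpow_natAbs : (q ^ 2) ^ d.natAbs = 1 := by
    cases d <;> simpa using h
  exact hpow N (by omega) (hN ▸ hpow_natAbs)

variable {S : Finset (Cell m)} {x y : Cell m} {e : ℕ}

theorem fst_eq (P : SemisimpleParameters q v n) (hS : IsLowerSet (S : Set (Cell m)))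
    (hcard : S.card + e ≤ n + 1) (hx : x ∈ S) (hy : y ∈ S)
    (h : q ^ (2 * e) * cellContent q v x = cellContent q v y) : x.1 = y.1 := by
  by_contra hne
  have hxy := Cell.diagonal_sub_diagonal_add_two_le hS hx hy
  have hyx := Cell.diagonal_sub_diagonal_add_two_le hS hy hx
  rw [if_neg hne] at hxy
  rw [if_neg (Ne.symm hne)] at hyx
  refine P.separated (e + x.diagonal - y.diagonal) x.1 y.1 hne (by omega) (by omega)
    (sub_eq_zero.2 ?_)
  have hq := P.q_ne_zero
  apply mul_right_cancel₀ (zpow_ne_zero (2 * y.diagonal) hq)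
  rw [← cellContent, ← h, cellContent, mul_right_comm, ← zpow_add₀ hq, mul_left_comm,
    ← zpow_natCast, ← zpow_add₀ hq, mul_comm]
  congr 2
  push_cast
  ring

theorem diagonal_eq (P : SemisimpleParameters q v n) (hn : 2 ≤ n)
    (hS : IsLowerSet (S : Set (Cell m))) (hcard : S.card + e ≤ n + 1) (hx : x ∈ S) (hy : y ∈ S)
    (h : q ^ (2 * e) * cellContent q v x = cellContent q v y) : e + x.diagonal = y.diagonal := by
  have hk := P.fst_eq hS hcard hx hy h
  by_contra hne
  have hxy := Cell.diagonal_sub_diagonal_add_two_le hS hx hy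
  have hyx := Cell.diagonal_sub_diagonal_add_two_le hS hy hx
  rw [if_pos hk] at hxy
  rw [if_pos hk.symm] at hyx
  refine P.zpow_ne_one hn (sub_ne_zero.2 hne) (by omega) ?_
  have hq := P.q_ne_zero
  rw [cellContent, cellContent, hk, mul_left_comm] at h
  rw [mul_sub, zpow_sub₀ hq, div_eq_one_iff_eq (zpow_ne_zero _ hq), mul_add, zpow_add₀ hq]
  exact_mod_cast mul_left_cancel₀ (P.v_ne_zero _) h

theorem le_total_of_cellContent_eq (P : SemisimpleParameters q v n) (hn : 2 ≤ n)
    (hS : IsLowerSet (S : Set (Cell m))) (he : e ≤ 1) (hcard : S.card + e ≤ n + 1) (hx : x ∈ S)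
    (hy : y ∈ S) (h : q ^ (2 * e) * cellContent q v x = cellContent q v y) : x ≤ y ∨ y ≤ x := by
  have hd := P.diagonal_eq hn hS hcard hx hy h
  exact Cell.le_total_of_diagonal (P.fst_eq hS hcard hx hy h) (by omega) (by omega)

theorem eq_of_cellContent_eq (P : SemisimpleParameters q v n)
    (hS : IsLowerSet (S : Set (Cell m))) (hcard : S.card < n) (hx : Minimal (· ∉ S) x)
    (hy : Minimal (· ∉ S) y) (h : cellContent q v x = cellContent q v y) : x = y := by
  suffices hcomp : x ≤ y ∨ y ≤ x from
    hcomp.elim (fun hxy => (hxy.antisymm (hy.le_of_le hx.prop hxy)))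
      fun hyx => (hx.le_of_le hy.prop hyx).antisymm hyx
  by_contra! hincomp
  have hy' : Minimal (· ∉ insert x S) y := by
    refine ⟨fun hmem => ?_, fun z hz => hy.2 fun hzS => hz (Finset.mem_insert_of_mem hzS)⟩
    exact (Finset.mem_insert.1 hmem).elim (fun hyx => hincomp.1 hyx.ge) hy.prop
  have hT := isLowerSet_insert (isLowerSet_insert hS hx) hy'
  have hTcard : (insert y (insert x S)).card + 0 ≤ n + 1 := by
    have := Finset.card_insert_le x S
    have := Finset.card_insert_le y (insert x S)
    omega
  have hxT : x ∈ insert y (insert x S) := by simp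
  have hyT : y ∈ insert y (insert x S) := by simp
  have h0 : q ^ (2 * 0) * cellContent q v x = cellContent q v y := by
    rw [mul_zero, pow_zero, one_mul, h]
  rcases le_or_gt 2 n with hn | hn
  · exact not_or.2 hincomp (P.le_total_of_cellContent_eq hn hT zero_le_one hTcard hxT hyT h0)
  · -- Here `S` is empty, so `x` is a corner node.
    obtain rfl : S = ∅ := Finset.card_eq_zero.1 (by omega)
    have hcorner : x ≤ ⟨x.1, (0, 0)⟩ :=
      hx.le_of_le (Finset.notMem_empty _) (Cell.le_iff.2 ⟨rfl, Nat.zero_le _, Nat.zero_le _⟩)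
    have hk := P.fst_eq hT hTcard hxT hyT h0
    exact hincomp.1 (hcorner.trans (Cell.le_iff.2 ⟨hk, Nat.zero_le _, Nat.zero_le _⟩))

end SemisimpleParameters

theorem cellContent_eq_mul_of_covBy (hq : q ≠ 0) {x y : Cell m} (h : x ⋖ y) :
    cellContent q v y = q ^ 2 * cellContent q v x ∨
      cellContent q v x = q ^ 2 * cellContent q v y := by
  have shift {x y : Cell m} (hk : x.1 = y.1) (hd : y.diagonal = x.diagonal + 1) :
      cellContent q v y = q ^ 2 * cellContent q v x := by
    rw [cellContent, cellContent, hk, hd, mul_add, zpow_add₀ hq, mul_one, zpow_ofNat, ← mul_assoc,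
      mul_comm]
  obtain ⟨hk, hd | hd⟩ := Cell.diagonal_of_covBy h
  exacts [.inl (shift hk hd), .inr (shift hk.symm hd)]

namespace StandardTableau

variable {lam : MultiPartition m n}

theorem content_ne (P : SemisimpleParameters q v n) (X : StandardTableau lam) {i j : Fin n}
    (hij : i < j) (hj : j.1 < i.1 + 3) : content q v X i ≠ content q v X j := by
  intro h
  have h0 : q ^ (2 * 0) * cellContent q v (X.pos i) = cellContent q v (X.pos j) := by
    rw [mul_zero, pow_zero, one_mul]
    exact h
  have hcard : (cellsOf lam).card + 0 ≤ n + 1 := by rw [card_cellsOf]; omega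
  have hS := isLowerSet_cellsOf lam
  have hk := P.fst_eq hS hcard (X.pos_mem i) (X.pos_mem j) h0
  have hd := P.diagonal_eq (by omega) hS hcard (X.pos_mem i) (X.pos_mem j) h0
  have := X.add_three_le_of_diagonal_eq hij hk (by simpa using hd)
  omega

theorem content_adjacent_iff (P : SemisimpleParameters q v n) (X : StandardTableau lam) {i : ℕ}
    (h : i + 1 < n) :
    (content q v X ⟨i + 1, h⟩ = q ^ 2 * content q v X ⟨i, by omega⟩ ∨
      content q v X ⟨i, by omega⟩ = q ^ 2 * content q v X ⟨i + 1, h⟩) ↔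
      X.pos ⟨i, by omega⟩ < X.pos ⟨i + 1, h⟩ := by
  refine ⟨fun hor => X.pos_lt_of_le_or_le (Nat.lt_succ_self i) ?_, fun hlt =>
    cellContent_eq_mul_of_covBy P.q_ne_zero (X.pos_covBy_pos h hlt)⟩
  have comparable {a b : Fin n} (hab : content q v X b = q ^ 2 * content q v X a) :
      X.pos a ≤ X.pos b ∨ X.pos b ≤ X.pos a :=
    P.le_total_of_cellContent_eq (by omega) (isLowerSet_cellsOf lam) le_rfl
      (by rw [card_cellsOf]) (X.pos_mem a) (X.pos_mem b) hab.symm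
  exact hor.elim comparable fun hab => (comparable hab).symm

theorem pos_eq_of_content_eq (P : SemisimpleParameters q v n) {mu : MultiPartition m n}
    (X : StandardTableau lam) (Y : StandardTableau mu)
    (hXY : ∀ i, content q v X i = content q v Y i) : X.pos = Y.pos := by
  funext i
  induction i using WellFoundedLT.induction with
  | ind i ih =>
  have himage : (Finset.Iio i).image X.pos = (Finset.Iio i).image Y.pos :=
    Finset.image_congr fun j hj => ih j (Finset.mem_Iio.1 hj)
  have hcard : ((Finset.Iio i).image X.pos).card < n :=
    Finset.card_image_le.trans_lt (by simp)
  exact P.eq_of_cellContent_eq (X.isLowerSet_image_pos i) hcard (X.minimal_pos i)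
    (himage ▸ Y.minimal_pos i) (hXY i)

end StandardTableau

end Contents

/-! ### Hecke operators on sequences -/

section Coefficients

variable {K : Type*} [Field K] {q x y z : K}

/-- The diagonal coefficient of the operators `σ_i`, for neighbouring contents `x` and `y`. -/
def diagCoeff (q x y : K) : K := -((q - q⁻¹) * (y / (x - y)))

open Classical in
/-- The off-diagonal coefficient of the operators `σ_i`, for neighbouring contents `x` and `y`. It
is set to zero on both sides of a forbidden exchange, although the formula gives zero on only one:
this makes sequences and tableaux behave alike. -/
noncomputable def swapCoeff (q x y : K) : K :=
  if y = q ^ 2 * x ∨ x = q ^ 2 * y then 0 else (q * y - q⁻¹ * x) / (y - x)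

theorem swapCoeff_ne_zero (hq : q ≠ 0) (hxy : x ≠ y)
    (h : ¬ (y = q ^ 2 * x ∨ x = q ^ 2 * y)) : swapCoeff q x y ≠ 0 := by
  rw [swapCoeff, if_neg h]
  refine div_ne_zero (fun hnum => h (.inr ?_)) (sub_ne_zero.2 hxy.symm)
  rw [sq, mul_assoc, sub_eq_zero.1 hnum, mul_inv_cancel_left₀ hq]

theorem swapCoeff_mul_swapCoeff (hq : q ≠ 0) (hxy : x ≠ y) :
    swapCoeff q x y * swapCoeff q y x =
      (q - q⁻¹) * diagCoeff q x y + 1 - diagCoeff q x y ^ 2 := by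
  have hsub : x - y ≠ 0 := sub_ne_zero.2 hxy
  have hformula : (q * y - q⁻¹ * x) / (y - x) * ((q * x - q⁻¹ * y) / (x - y)) =
      (q - q⁻¹) * diagCoeff q x y + 1 - diagCoeff q x y ^ 2 := by
    rw [diagCoeff, ← neg_sub x y]
    field_simp
    ring
  by_cases h : y = q ^ 2 * x ∨ x = q ^ 2 * y
  · have hzero {a b : K} (hab : b = q ^ 2 * a) : q * a - q⁻¹ * b = 0 := by
      rw [hab]
      field_simp
      ring
    rw [swapCoeff, if_pos h, zero_mul, ← hformula]
    rcases h with h | h <;> simp only [hzero h, zero_div, mul_zero, zero_mul]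
  · rw [swapCoeff, if_neg h, swapCoeff, if_neg (mt Or.symm h), hformula]

theorem diagCoeff_mul_sub (hxy : x ≠ y) : diagCoeff q x y * (x - y) = -((q - q⁻¹) * y) := by
  rw [diagCoeff, neg_mul, mul_assoc, div_mul_cancel₀ _ (sub_ne_zero.2 hxy)]

theorem diagCoeff_mul_add (hxy : x ≠ y) : diagCoeff q x y * x + diagCoeff q y x * y = 0 := by
  have hsub : x - y ≠ 0 := sub_ne_zero.2 hxy
  rw [diagCoeff, diagCoeff, ← neg_sub x y]
  field_simp
  ring

theorem diagCoeff_add (hxy : x ≠ y) : diagCoeff q x y + diagCoeff q y x = q - q⁻¹ := by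
  have hsub : x - y ≠ 0 := sub_ne_zero.2 hxy
  rw [diagCoeff, diagCoeff, ← neg_sub x y]
  field_simp
  ring

theorem diagCoeff_mul_diagCoeff (hxy : x ≠ y) (hyz : y ≠ z) (hxz : x ≠ z) :
    diagCoeff q x y * diagCoeff q y z + diagCoeff q x z * diagCoeff q y x =
      diagCoeff q y z * diagCoeff q x z := by
  have hsub : x - y ≠ 0 := sub_ne_zero.2 hxy
  have hsub' : y - z ≠ 0 := sub_ne_zero.2 hyz
  have hsub'' : x - z ≠ 0 := sub_ne_zero.2 hxz
  simp only [diagCoeff, ← neg_sub x y, div_neg]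
  generalize q - q⁻¹ = δ
  field_simp
  ring

theorem diagCoeff_braid (hq : q ≠ 0) (hxy : x ≠ y) (hyz : y ≠ z) (hxz : x ≠ z) :
    diagCoeff q x y * diagCoeff q y z * diagCoeff q x y +
        swapCoeff q x y * diagCoeff q x z * swapCoeff q y x =
      diagCoeff q y z * diagCoeff q x y * diagCoeff q y z +
        swapCoeff q y z * diagCoeff q x z * swapCoeff q z y := by
  linear_combination diagCoeff q x z * swapCoeff_mul_swapCoeff hq hxy -
    diagCoeff q x z * swapCoeff_mul_swapCoeff hq hyz +
    (diagCoeff q x y - diagCoeff q y z) *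
      (diagCoeff_mul_diagCoeff (q := q) hxy hyz hxz - diagCoeff q x z * diagCoeff_add (q := q) hxy)

end Coefficients

section SequenceOperators

variable {K ι κ : Type*} [Field K]

/-- The operator which multiplies a sequence by the content of its term `a`. -/
noncomputable def seqContentOp (χ : κ → K) (a : ι) : Module.End K ((ι → κ) →₀ K) :=
  Finsupp.linearCombination K fun p => χ (p a) • Finsupp.single p (1 : K)

/-- The operator with the matrix entries of `σ_i` which exchanges the terms `a` and `b` of a
sequence, where `χ` gives the content of a term. It acts on all sequences, so its relations need no
case distinction according to whether an exchange leads to a standard tableau. -/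
noncomputable def seqOp [DecidableEq ι] (q : K) (χ : κ → K) (a b : ι) :
    Module.End K ((ι → κ) →₀ K) :=
  Finsupp.linearCombination K fun p =>
    diagCoeff q (χ (p a)) (χ (p b)) • Finsupp.single p (1 : K) +
      swapCoeff q (χ (p a)) (χ (p b)) • Finsupp.single (p ∘ Equiv.swap a b) (1 : K)

variable {q : K} {χ : κ → K}

theorem seqContentOp_single (a : ι) (p : ι → κ) :
    seqContentOp χ a (Finsupp.single p 1) = χ (p a) • Finsupp.single p (1 : K) := by
  rw [seqContentOp, Finsupp.linearCombination_single, one_smul]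

variable [DecidableEq ι] {a b c d : ι} {p : ι → κ}

theorem seqOp_single (a b : ι) (p : ι → κ) :
    seqOp q χ a b (Finsupp.single p 1) =
      diagCoeff q (χ (p a)) (χ (p b)) • Finsupp.single p (1 : K) +
      swapCoeff q (χ (p a)) (χ (p b)) • Finsupp.single (p ∘ Equiv.swap a b) (1 : K) := by
  rw [seqOp, Finsupp.linearCombination_single, one_smul]

theorem seqOp_quadratic (hq : q ≠ 0) (h : χ (p a) ≠ χ (p b)) :
    seqOp q χ a b (seqOp q χ a b (Finsupp.single p 1)) =
      (q - q⁻¹) • seqOp q χ a b (Finsupp.single p 1) + Finsupp.single p 1 := by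
  simp only [seqOp_single, map_add, map_smul, comp_swap_comp_swap, Function.comp_apply,
    Equiv.swap_apply_left, Equiv.swap_apply_right, smul_add, smul_smul,
    swapCoeff_mul_swapCoeff hq h, eq_sub_of_add_eq' (diagCoeff_add (q := q) h)]
  module

theorem seqOp_seqContentOp_seqOp (hq : q ≠ 0) (h : χ (p a) ≠ χ (p b)) :
    seqOp q χ a b (seqContentOp χ a (seqOp q χ a b (Finsupp.single p 1))) =
      seqContentOp χ b (Finsupp.single p 1) := by
  simp only [seqOp_single, seqContentOp_single, map_add, map_smul, comp_swap_comp_swap,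
    Function.comp_apply, Equiv.swap_apply_left, Equiv.swap_apply_right, smul_add, smul_smul]
  set x := χ (p a)
  set y := χ (p b)
  have hdiag : diagCoeff q x y * x * diagCoeff q x y +
      swapCoeff q x y * y * swapCoeff q y x = y := by
    linear_combination y * swapCoeff_mul_swapCoeff hq h +
      diagCoeff q x y * diagCoeff_mul_sub (q := q) h
  have hswap : diagCoeff q x y * x * swapCoeff q x y +
      swapCoeff q x y * y * diagCoeff q y x = 0 := by
    linear_combination swapCoeff q x y * diagCoeff_mul_add (q := q) h
  linear_combination (norm := module) hdiag • (Finsupp.single p (1 : K)) +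
    hswap • Finsupp.single (p ∘ Equiv.swap a b) (1 : K)

theorem seqOp_comm (hac : a ≠ c) (had : a ≠ d) (hbc : b ≠ c) (hbd : b ≠ d) (p : ι → κ) :
    seqOp q χ a b (seqOp q χ c d (Finsupp.single p 1)) =
      seqOp q χ c d (seqOp q χ a b (Finsupp.single p 1)) := by
  have hperm : (p ∘ Equiv.swap c d) ∘ Equiv.swap a b = (p ∘ Equiv.swap a b) ∘ Equiv.swap c d := by
    have hmul : Equiv.swap c d * Equiv.swap a b = Equiv.swap a b * Equiv.swap c d := by
      rw [Equiv.mul_swap_eq_swap_mul, Equiv.swap_apply_of_ne_of_ne hac had,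
        Equiv.swap_apply_of_ne_of_ne hbc hbd]
    exact congrArg (fun g : Equiv.Perm ι => p ∘ g) hmul
  simp only [seqOp_single, map_add, map_smul, Function.comp_apply, hperm,
    Equiv.swap_apply_of_ne_of_ne hac had, Equiv.swap_apply_of_ne_of_ne hbc hbd,
    Equiv.swap_apply_of_ne_of_ne hac.symm hbc.symm, Equiv.swap_apply_of_ne_of_ne had.symm hbd.symm]
  module

theorem seqContentOp_comm (hac : a ≠ c) (had : a ≠ d) (p : ι → κ) :
    seqContentOp χ a (seqOp q χ c d (Finsupp.single p 1)) =
      seqOp q χ c d (seqContentOp χ a (Finsupp.single p 1)) := by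
  simp only [seqOp_single, seqContentOp_single, map_add, map_smul, Function.comp_apply,
    Equiv.swap_apply_of_ne_of_ne hac had]
  module

theorem seqOp_braid (hq : q ≠ 0) (hab : a ≠ b) (hbc : b ≠ c) (hac : a ≠ c)
    (hxy : χ (p a) ≠ χ (p b)) (hyz : χ (p b) ≠ χ (p c)) (hxz : χ (p a) ≠ χ (p c)) :
    seqOp q χ a b (seqOp q χ b c (seqOp q χ a b (Finsupp.single p 1))) =
      seqOp q χ b c (seqOp q χ a b (seqOp q χ b c (Finsupp.single p 1))) := by
  have hperm : ((p ∘ Equiv.swap a b) ∘ Equiv.swap b c) ∘ Equiv.swap a b =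
      ((p ∘ Equiv.swap b c) ∘ Equiv.swap a b) ∘ Equiv.swap b c := by
    have hmul : Equiv.swap a b * Equiv.swap b c * Equiv.swap a b =
        Equiv.swap b c * Equiv.swap a b * Equiv.swap b c := by
      rw [Equiv.swap_mul_swap_mul_swap hab hac, Equiv.swap_comm a b, Equiv.swap_comm b c,
        Equiv.swap_mul_swap_mul_swap hbc.symm hac.symm, Equiv.swap_comm]
    exact congrArg (fun g : Equiv.Perm ι => p ∘ g) hmul
  simp only [seqOp_single, map_add, map_smul, comp_swap_comp_swap, Function.comp_apply,
    Equiv.swap_apply_left, Equiv.swap_apply_right, Equiv.swap_apply_of_ne_of_ne hab hac,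
    Equiv.swap_apply_of_ne_of_ne hac.symm hbc.symm, hperm]
  set x := χ (p a)
  set y := χ (p b)
  set z := χ (p c)
  have hmul := diagCoeff_mul_diagCoeff (q := q) hxy hyz hxz
  have hdiag := diagCoeff_braid hq hxy hyz hxz
  have hleft : diagCoeff q x y * diagCoeff q y z * swapCoeff q x y +
      swapCoeff q x y * diagCoeff q x z * diagCoeff q y x =
      diagCoeff q y z * swapCoeff q x y * diagCoeff q x z := by
    linear_combination swapCoeff q x y * hmul
  have hright : diagCoeff q x y * swapCoeff q y z * diagCoeff q x z =
      diagCoeff q y z * diagCoeff q x y * swapCoeff q y z +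
      swapCoeff q y z * diagCoeff q x z * diagCoeff q z y := by
    linear_combination swapCoeff q y z *
      (-hmul + diagCoeff q x z * (diagCoeff_add (q := q) hxy - diagCoeff_add (q := q) hyz))
  linear_combination (norm := module) hdiag • (Finsupp.single p (1 : K)) +
    hleft • Finsupp.single (p ∘ Equiv.swap a b) (1 : K) +
    hright • Finsupp.single (p ∘ Equiv.swap b c) (1 : K)

end SequenceOperators

/-! ### The representation on standard tableaux -/

section DiagonalOperators

variable {K T : Type*} [Field K]

/-- The operator on the space with basis `T` which multiplies each `X : T` by `g X`, as an algebra
homomorphism in `g`. -/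
noncomputable def diagOp (K T : Type*) [Field K] : (T → K) →ₐ[K] Module.End K (T →₀ K) :=
  AlgHom.ofLinearMap
    { toFun := fun g => Finsupp.linearCombination K fun X => g X • Finsupp.single X (1 : K)
      map_add' := fun f g => Finsupp.lhom_ext' fun X => LinearMap.ext_ring (by simp)
      map_smul' := fun c g => Finsupp.lhom_ext' fun X => LinearMap.ext_ring (by simp) }
    (Finsupp.lhom_ext' fun X => LinearMap.ext_ring (by simp))
    (fun f g => Finsupp.lhom_ext' fun X => LinearMap.ext_ring (by simp [mul_comm]))

theorem diagOp_single (g : T → K) (X : T) :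
    diagOp K T g (Finsupp.single X 1) = g X • Finsupp.single X (1 : K) := by
  change Finsupp.linearCombination K (fun X => g X • Finsupp.single X (1 : K)) _ = _
  rw [Finsupp.linearCombination_single, one_smul]

end DiagonalOperators

section Representation

variable {K : Type*} [Field K] {m n : ℕ} {q : K} {v : Fin m → K}

/-- The embedding of `V_lam` into the space with basis the sequences of nodes, which turns the
operators on tableaux into operators on sequences. -/
noncomputable def posMap (K : Type*) [Field K] (lam : MultiPartition m n) :
    TableauSpace K lam →ₗ[K] ((Fin n → Cell m) →₀ K) :=
  Finsupp.lmapDomain K K StandardTableau.pos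

variable {lam : MultiPartition m n}

theorem posMap_single (X : StandardTableau lam) (c : K) :
    posMap K lam (Finsupp.single X c) = Finsupp.single X.pos c := by
  rw [posMap, Finsupp.lmapDomain_apply, Finsupp.mapDomain_single]

theorem end_ext_posMap {f g : Module.End K (TableauSpace K lam)}
    (h : ∀ X : StandardTableau lam,
      posMap K lam (f (Finsupp.single X 1)) = posMap K lam (g (Finsupp.single X 1))) : f = g := by
  have hinj : Function.Injective (posMap K lam) :=
    Finsupp.mapDomain_injective fun _ _ h => StandardTableau.eq_of_pos_eq h
  exact Finsupp.lhom_ext' fun X => LinearMap.ext_ring (hinj (h X))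

theorem sigmaOp_single (X : StandardTableau lam) {i : ℕ} (h : i + 1 < n) :
    sigmaOp q v lam i h (Finsupp.single X 1) =
      diagCoeff q (content q v X ⟨i, by omega⟩) (content q v X ⟨i + 1, h⟩) •
          Finsupp.single X (1 : K) +
        ((q * content q v X ⟨i + 1, h⟩ - q⁻¹ * content q v X ⟨i, by omega⟩) /
          (content q v X ⟨i + 1, h⟩ - content q v X ⟨i, by omega⟩)) • swapVector K X i h := by
  rw [sigmaOp, Finsupp.linearCombination_single, one_smul, diagCoeff]

theorem posMap_sigmaOp_single (P : SemisimpleParameters q v n) (X : StandardTableau lam) {i : ℕ}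
    (h : i + 1 < n) :
    posMap K lam (sigmaOp q v lam i h (Finsupp.single X 1)) =
      seqOp q (cellContent q v) ⟨i, by omega⟩ ⟨i + 1, h⟩ (Finsupp.single X.pos 1) := by
  rw [sigmaOp_single, seqOp_single, map_add, map_smul, map_smul, posMap_single]
  have hadj := (X.content_adjacent_iff P h).trans
    (not_iff_comm.1 (X.swap_isStandard_iff h).symm).symm
  simp only [content_eq_cellContent] at hadj ⊢
  congr 1
  by_cases hs : IsStandard lam (X.entry.trans (Equiv.swap ⟨i, by omega⟩ ⟨i + 1, h⟩))
  · rw [swapVector, dif_pos hs, posMap_single, swapCoeff, if_neg fun hw => hadj.1 hw hs]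
    rfl
  · rw [swapVector, dif_neg hs, map_zero, smul_zero, swapCoeff, if_pos (hadj.2 hs), zero_smul]

theorem posMap_sigmaOp (P : SemisimpleParameters q v n) {i : ℕ} (h : i + 1 < n)
    (w : TableauSpace K lam) :
    posMap K lam (sigmaOp q v lam i h w) =
      seqOp q (cellContent q v) ⟨i, by omega⟩ ⟨i + 1, h⟩ (posMap K lam w) := by
  suffices hcomp : posMap K lam ∘ₗ sigmaOp q v lam i h =
      seqOp q (cellContent q v) ⟨i, by omega⟩ ⟨i + 1, h⟩ ∘ₗ posMap K lam from
    LinearMap.congr_fun hcomp w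
  refine Finsupp.lhom_ext' fun X => LinearMap.ext_ring ?_
  exact (posMap_sigmaOp_single P X h).trans (congrArg _ (posMap_single X 1).symm)

/-- The operator on `V_lam` which multiplies each tableau by the content of its entry `i`. -/
noncomputable def contentOp (q : K) (v : Fin m → K) (lam : MultiPartition m n) (i : Fin n) :
    Module.End K (TableauSpace K lam) :=
  diagOp K (StandardTableau lam) fun X => content q v X i

theorem tauOp_eq_contentOp (lam : MultiPartition m n) (h : 0 < n) :
    tauOp q v lam h = contentOp q v lam ⟨0, h⟩ := rfl

theorem posMap_contentOp (i : Fin n) (w : TableauSpace K lam) :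
    posMap K lam (contentOp q v lam i w) =
      seqContentOp (cellContent q v) i (posMap K lam w) := by
  suffices hcomp : posMap K lam ∘ₗ contentOp q v lam i =
      seqContentOp (cellContent q v) i ∘ₗ posMap K lam from
    LinearMap.congr_fun hcomp w
  refine Finsupp.lhom_ext' fun X => LinearMap.ext_ring ?_
  change posMap K lam (contentOp q v lam i (Finsupp.single X 1)) =
    seqContentOp (cellContent q v) i (posMap K lam (Finsupp.single X 1))
  rw [contentOp, diagOp_single, map_smul, posMap_single, seqContentOp_single,
    content_eq_cellContent]

theorem sigmaOp_mul_contentOp_mul_sigmaOp (P : SemisimpleParameters q v n)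
    (lam : MultiPartition m n) {i : ℕ} (h : i + 1 < n) :
    sigmaOp q v lam i h * contentOp q v lam ⟨i, by omega⟩ * sigmaOp q v lam i h =
      contentOp q v lam ⟨i + 1, h⟩ := by
  refine end_ext_posMap fun X => ?_
  simp only [Module.End.mul_apply, posMap_sigmaOp P, posMap_contentOp, posMap_single]
  exact seqOp_seqContentOp_seqOp P.q_ne_zero (X.content_ne P (by simp [Fin.lt_def]) (by simp))

theorem aeval_tauOp (lam : MultiPartition m n) (h : 0 < n) :
    Polynomial.aeval (tauOp q v lam h) (tauPolynomial v) = 0 := by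
  rw [tauOp_eq_contentOp, contentOp, Polynomial.aeval_algHom_apply]
  convert map_zero (diagOp K (StandardTableau lam))
  funext X
  have hroot : content q v X ⟨0, h⟩ = v (X.pos ⟨0, h⟩).1 := by
    rw [content_eq_cellContent, cellContent, Cell.diagonal, X.pos_zero]
    simp
  simp only [tauPolynomial, map_prod, map_sub, Polynomial.aeval_X, Polynomial.aeval_C,
    Finset.prod_apply, Pi.sub_apply, Pi.algebraMap_apply, Algebra.algebraMap_self,
    RingHom.id_apply, Pi.zero_apply]
  exact Finset.prod_eq_zero (Finset.mem_univ (X.pos ⟨0, h⟩).1) (by rw [hroot, sub_self])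

/-- The operator of `τ` on `V_lam`, set to `0` in the degenerate case `n = 0`. -/
noncomputable def tauAction (q : K) (v : Fin m → K) (lam : MultiPartition m n) :
    Module.End K (TableauSpace K lam) :=
  if h : 0 < n then tauOp q v lam h else 0

/-- The operators of the `σ_i` on `V_lam`, extended by `0` to all natural indices. -/
noncomputable def sigmaAction (q : K) (v : Fin m → K) (lam : MultiPartition m n) (i : ℕ) :
    Module.End K (TableauSpace K lam) :=
  if h : i + 1 < n then sigmaOp q v lam i h else 0

theorem tauAction_of_pos (lam : MultiPartition m n) (h : 0 < n) :
    tauAction q v lam = contentOp q v lam ⟨0, h⟩ :=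
  dif_pos h

theorem sigmaAction_of_lt (lam : MultiPartition m n) {i : ℕ} (h : i + 1 < n) :
    sigmaAction q v lam i = sigmaOp q v lam i h :=
  dif_pos h

theorem isAffineHeckeFamily_sigmaAction (P : SemisimpleParameters q v n)
    (lam : MultiPartition m n) :
    IsAffineHeckeFamily (q - q⁻¹) n (tauAction q v lam) (sigmaAction q v lam) where
  braid i h := by
    rw [sigmaAction_of_lt lam h, sigmaAction_of_lt lam (by omega)]
    refine end_ext_posMap fun X => ?_
    simp only [Module.End.mul_apply, posMap_sigmaOp P, posMap_single]
    exact seqOp_braid P.q_ne_zero (by simp) (by simp) (by simp [add_assoc])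
      (X.content_ne P (by simp [Fin.lt_def]) (by simp))
      (X.content_ne P (by simp [Fin.lt_def]) (by simp))
      (X.content_ne P (by simp [Fin.lt_def]) (by simp))
  comm i j hij h := by
    rw [sigmaAction_of_lt lam h, sigmaAction_of_lt lam (by omega)]
    refine end_ext_posMap fun X => ?_
    simp only [Module.End.mul_apply, posMap_sigmaOp P, posMap_single]
    refine seqOp_comm ?_ ?_ ?_ ?_ _ <;> simp only [ne_eq, Fin.mk.injEq] <;> omega
  tau_braid h := by
    rw [sigmaAction_of_lt lam h, tauAction_of_pos lam (by omega), mul_assoc, mul_assoc,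
      ← mul_assoc (sigmaOp q v lam 0 h), sigmaOp_mul_contentOp_mul_sigmaOp P lam h, contentOp,
      contentOp, ← map_mul, ← map_mul, mul_comm]
  tau_comm i hi h := by
    rw [sigmaAction_of_lt lam h, tauAction_of_pos lam (by omega)]
    refine end_ext_posMap fun X => ?_
    simp only [Module.End.mul_apply, posMap_sigmaOp P, posMap_contentOp, posMap_single]
    refine seqContentOp_comm ?_ ?_ _ <;> simp only [ne_eq, Fin.mk.injEq] <;> omega
  quadratic i h := by
    rw [sigmaAction_of_lt lam h]
    refine end_ext_posMap fun X => ?_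
    simp only [sq, Module.End.mul_apply, LinearMap.add_apply, LinearMap.smul_apply,
      Module.End.one_apply, map_add, map_smul, posMap_sigmaOp P, posMap_single]
    exact seqOp_quadratic P.q_ne_zero (X.content_ne P (by simp [Fin.lt_def]) (by simp))

/-- The representation of `H(m,1,n)` on `V_lam`. -/
noncomputable def tableauRep (P : SemisimpleParameters q v n) (lam : MultiPartition m n) :
    HeckeAlgebra q v n →ₐ[K] Module.End K (TableauSpace K lam) :=
  HeckeAlgebra.lift (isAffineHeckeFamily_sigmaAction P lam) fun h => by
    rw [tauAction_of_pos lam h]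
    exact aeval_tauOp lam h

theorem tableauRep_tau (P : SemisimpleParameters q v n) (lam : MultiPartition m n) (h : 0 < n) :
    tableauRep P lam (tau q v h) = tauOp q v lam h :=
  (HeckeAlgebra.lift_tau _ _ h).trans (tauAction_of_pos lam h)

theorem tableauRep_sigma (P : SemisimpleParameters q v n) (lam : MultiPartition m n) {i : ℕ}
    (h : i + 1 < n) : tableauRep P lam (sigma q v i h) = sigmaOp q v lam i h :=
  (HeckeAlgebra.lift_sigma _ _ h).trans (sigmaAction_of_lt lam h)

end Representation

/-! ### Subalgebras of products of endomorphism algebras -/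

section MatrixUnits

theorem subalgebra_eq_top_of_separatesPoints {K T : Type*} [Field K] [Finite T]
    {D : Subalgebra K (T → K)} (hD : ∀ x y : T, x ≠ y → ∃ f ∈ D, f x ≠ f y) : D = ⊤ := by
  classical
  have := Fintype.ofFinite T
  have hsingle (x : T) : Pi.single x (1 : K) ∈ D := by
    choose! f hfD hf using hD x
    -- Lagrange interpolation
    have hprod : ∏ y ∈ Finset.univ.erase x,
        ((f y x - f y y)⁻¹ • (f y - algebraMap K (T → K) (f y y))) ∈ D :=
      D.prod_mem fun y hy => D.smul_mem
        (D.sub_mem (hfD y (Finset.ne_of_mem_erase hy).symm) (D.algebraMap_mem _)) _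
    convert hprod using 1
    funext z
    rw [Finset.prod_apply]
    by_cases hz : z = x
    · subst hz
      rw [Pi.single_eq_same, Finset.prod_eq_one]
      intro y hy
      exact inv_mul_cancel₀ (sub_ne_zero.2 (hf y (Finset.ne_of_mem_erase hy).symm))
    · rw [Pi.single_eq_of_ne hz,
        Finset.prod_eq_zero (Finset.mem_erase.2 ⟨hz, Finset.mem_univ z⟩) (by simp)]
  refine Algebra.eq_top_iff.2 fun g => ?_
  rw [pi_eq_sum_univ' g]
  exact D.sum_mem fun x _ => D.smul_mem (hsingle x) _

variable {K ι : Type*} {T : ι → Type*} [Field K]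

theorem mul_lapply_smulRight {T : Type*} (f : Module.End K (T →₀ K)) (Y : T) (u : T →₀ K) :
    f * (Finsupp.lapply Y).smulRight u = (Finsupp.lapply Y).smulRight (f u) :=
  LinearMap.ext fun w => map_smul f (w Y) u

theorem diagOp_piSingle {T : Type*} [DecidableEq T] (X : T) :
    diagOp K T (Pi.single X 1) = (Finsupp.lapply X).smulRight (Finsupp.single X 1) := by
  refine Finsupp.lhom_ext' fun Y => LinearMap.ext_ring ?_
  change diagOp K T (Pi.single X 1) (Finsupp.single Y 1) =
    Finsupp.single Y (1 : K) X • Finsupp.single X (1 : K)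
  rw [diagOp_single]
  by_cases h : Y = X
  · subst h; simp
  · simp [h]

/-- The operators which are diagonal in the bases `T i`, with entries given by a function on the
disjoint union of these bases. -/
noncomputable def piDiagOp (K : Type*) [Field K] (T : ι → Type*) :
    ((Σ i, T i) → K) →ₐ[K] ((i : ι) → Module.End K (T i →₀ K)) :=
  AlgHom.pi fun i => (diagOp K (T i)).comp (AlgHom.pi fun X => Pi.evalAlgHom K _ ⟨i, X⟩)

theorem piDiagOp_apply (g : (Σ i, T i) → K) (i : ι) :
    piDiagOp K T g i = diagOp K (T i) fun X => g ⟨i, X⟩ := rfl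

variable [DecidableEq ι]

theorem mul_piSingle {R : ι → Type*} [∀ i, MulZeroClass (R i)] (f : (i : ι) → R i) {i : ι}
    (g : R i) : f * Pi.single i g = Pi.single i (f i * g) := by
  funext j
  by_cases h : j = i
  · subst h; simp
  · simp [Pi.single_eq_of_ne h]

theorem piDiagOp_piSingle [∀ i, DecidableEq (T i)] {i : ι} (X : T i) :
    piDiagOp K T (Pi.single ⟨i, X⟩ 1) =
      Pi.single i ((Finsupp.lapply X).smulRight (Finsupp.single X 1)) := by
  funext j
  rw [piDiagOp_apply, ← diagOp_piSingle]
  by_cases h : j = i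
  · subst h
    rw [Pi.single_eq_same]
    congr 1
    funext Y
    simp [Pi.single_apply]
  · rw [Pi.single_eq_of_ne h]
    convert map_zero (diagOp K (T j)) with Y
    exact Pi.single_eq_of_ne (fun e => h (Sigma.mk.inj e).1) _

theorem piSingle_smulRight_mem_of_apply_ne_zero
    {D : Subalgebra K ((i : ι) → Module.End K (T i →₀ K))} (hdiag : ∀ g, piDiagOp K T g ∈ D)
    {f : (i : ι) → Module.End K (T i →₀ K)} (hf : f ∈ D) {i : ι} {Y X : T i} {u : T i →₀ K}
    (hu : Pi.single i ((Finsupp.lapply Y).smulRight u) ∈ D) (hX : f i u X ≠ 0) :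
    Pi.single i ((Finsupp.lapply Y).smulRight (Finsupp.single X 1)) ∈ D := by
  classical
  have hprod := D.mul_mem (hdiag (Pi.single ⟨i, X⟩ 1)) (D.mul_mem hf hu)
  rw [piDiagOp_piSingle, mul_piSingle, mul_piSingle, Pi.single_eq_same, mul_lapply_smulRight,
    mul_lapply_smulRight] at hprod
  have hscaled := D.smul_mem hprod (f i u X)⁻¹
  rwa [← Pi.single_smul, LinearMap.smulRight_apply, Finsupp.lapply_apply,
    ← LinearMap.smulRightₗ_apply, map_smul, inv_smul_smul₀ hX] at hscaled

theorem subalgebra_eq_top_of_matrixUnits [Finite ι] [∀ i, Finite (T i)]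
    {D : Subalgebra K ((i : ι) → Module.End K (T i →₀ K))}
    (hD : ∀ (i : ι) (X Y : T i),
      Pi.single i ((Finsupp.lapply Y).smulRight (Finsupp.single X 1)) ∈ D) : D = ⊤ := by
  have := Fintype.ofFinite ι
  have hrankOne (i : ι) (Y : T i) (u : T i →₀ K) :
      (LinearMap.single K (fun i => Module.End K (T i →₀ K)) i ∘ₗ
        LinearMap.smulRightₗ (Finsupp.lapply Y)) u ∈ D := by
    induction u using Finsupp.induction_linear with
    | zero => rw [map_zero]; exact D.zero_mem
    | add u w hu hw => rw [map_add]; exact D.add_mem hu hw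
    | single X c =>
      rw [← Finsupp.smul_single_one, map_smul]
      exact D.smul_mem (hD i X Y) c
  refine Algebra.eq_top_iff.2 fun f => ?_
  rw [← Finset.univ_sum_single f]
  refine D.sum_mem fun i _ => ?_
  have := Fintype.ofFinite (T i)
  have hsum : ∑ Y, (Finsupp.lapply Y).smulRight (f i (Finsupp.single Y 1)) = f i := by
    classical
    ext Y Z
    simp [Finsupp.single_apply]
  change LinearMap.single K (fun i => Module.End K (T i →₀ K)) i (f i) ∈ D
  rw [← hsum, map_sum]
  exact D.sum_mem fun Y _ => hrankOne i Y _

end MatrixUnits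

/-! ### Surjectivity -/

section Surjectivity

variable {K : Type*} [Field K] {m n : ℕ} {q : K} {v : Fin m → K}

theorem sigmaOp_single_apply_ne_zero (P : SemisimpleParameters q v n) {lam : MultiPartition m n}
    {X Y : StandardTableau lam} {i : ℕ} (h : i + 1 < n)
    (hXY : Y.pos = X.pos ∘ Equiv.swap ⟨i, by omega⟩ ⟨i + 1, h⟩) :
    sigmaOp q v lam i h (Finsupp.single X 1) Y ≠ 0 := by
  have hlt : (⟨i, by omega⟩ : Fin n) < ⟨i + 1, h⟩ := Nat.lt_succ_self i
  have hnlt : ¬ X.pos ⟨i, by omega⟩ < X.pos ⟨i + 1, h⟩ := by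
    intro hpos
    refine hlt.not_gt (Y.lt_of_pos_lt ?_)
    simpa only [hXY, Function.comp_apply, Equiv.swap_apply_left, Equiv.swap_apply_right] using hpos
  have hne : X.pos ≠ Y.pos := by
    intro heq
    have hi := congrFun heq ⟨i, by omega⟩
    rw [hXY, Function.comp_apply, Equiv.swap_apply_left] at hi
    exact hlt.ne (X.pos_injective hi)
  have hcoeff : sigmaOp q v lam i h (Finsupp.single X 1) Y =
      swapCoeff q (content q v X ⟨i, by omega⟩) (content q v X ⟨i + 1, h⟩) := by
    have hpos := DFunLike.congr_fun (posMap_sigmaOp_single P X h) Y.pos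
    rw [posMap, Finsupp.lmapDomain_apply,
      Finsupp.mapDomain_apply fun _ _ => StandardTableau.eq_of_pos_eq, seqOp_single, ← hXY] at hpos
    simpa [hne, ← content_eq_cellContent] using hpos
  rw [hcoeff]
  exact swapCoeff_ne_zero P.q_ne_zero (X.content_ne P hlt (by simp))
    (mt (X.content_adjacent_iff P h).1 hnlt)

/-- The representations on the spaces `V_lam`, taken together. -/
noncomputable def totalRep (P : SemisimpleParameters q v n) :
    HeckeAlgebra q v n →ₐ[K] ((lam : MultiPartition m n) → Module.End K (TableauSpace K lam)) :=
  AlgHom.pi (tableauRep P)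

theorem contentOp_mem_range_totalRep (P : SemisimpleParameters q v n) {i : ℕ} (hi : i < n) :
    (fun lam => contentOp q v lam ⟨i, hi⟩) ∈ (totalRep P).range := by
  induction i with
  | zero => exact ⟨tau q v hi, funext fun lam => tableauRep_tau P lam hi⟩
  | succ i ih =>
    obtain ⟨x, hx⟩ := ih (by omega)
    refine ⟨sigma q v i hi * x * sigma q v i hi, funext fun lam => ?_⟩
    have hx' : tableauRep P lam x = contentOp q v lam ⟨i, by omega⟩ := congrFun hx lam
    change tableauRep P lam _ = _
    rw [map_mul, map_mul, tableauRep_sigma, hx', sigmaOp_mul_contentOp_mul_sigmaOp P]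

theorem piDiagOp_mem_range_totalRep (P : SemisimpleParameters q v n)
    (g : (Σ lam : MultiPartition m n, StandardTableau lam) → K) :
    piDiagOp K StandardTableau g ∈ (totalRep P).range := by
  have htop : (totalRep P).range.comap (piDiagOp K StandardTableau) = ⊤ := by
    refine subalgebra_eq_top_of_separatesPoints ?_
    rintro ⟨lam, X⟩ ⟨mu, Y⟩ hne
    contrapose! hne
    exact StandardTableau.sigma_mk_eq_of_pos_eq <| X.pos_eq_of_content_eq P Y fun i =>
      hne (fun Z => content q v Z.2 i) (contentOp_mem_range_totalRep P i.isLt)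
  exact Subalgebra.mem_comap _ _ _ |>.1 (htop ▸ Algebra.mem_top)

theorem totalRep_surjective (P : SemisimpleParameters q v n) :
    Function.Surjective (totalRep P) := by
  classical
  rw [← AlgHom.range_eq_top]
  have hdiag := piDiagOp_mem_range_totalRep P
  refine subalgebra_eq_top_of_matrixUnits fun lam X Y => ?_
  refine StandardTableau.swap_induction (X := Y) (C := fun X => Pi.single lam
    ((Finsupp.lapply Y).smulRight (Finsupp.single X (1 : K))) ∈ (totalRep P).range) ?_ ?_ X
  · intro X X' i h hX' hX
    refine piSingle_smulRight_mem_of_apply_ne_zero hdiag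
      ((totalRep P).mem_range_self (sigma q v i h)) hX ?_
    change tableauRep P lam (sigma q v i h) _ _ ≠ 0
    rw [tableauRep_sigma]
    exact sigmaOp_single_apply_ne_zero P h hX'
  · rw [← piDiagOp_piSingle]
    exact hdiag _

end Surjectivity

/-! ### Modules over products of endomorphism algebras -/

section AsModule

variable {K A V : Type*} [Field K] [Ring A] [Algebra K A] [AddCommGroup V] [Module K V]

theorem smul_asModule (ρ : A →ₐ[K] Module.End K V) (a : A) (x : AsModule ρ) :
    a • x = (ρ a : V →ₗ[K] V) x := rfl

instance [Nontrivial V] (ρ : A →ₐ[K] Module.End K V) : Nontrivial (AsModule ρ) :=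
  inferInstanceAs (Nontrivial V)

theorem isSimpleModule_asModule [Nontrivial V] {ρ : A →ₐ[K] Module.End K V}
    (hρ : Function.Surjective ρ) : IsSimpleModule A (AsModule ρ) := by
  refine isSimpleModule_iff_toSpanSingleton_surjective.2
    ⟨inferInstance, fun (x : V) (hx : x ≠ 0) w => ?_⟩
  obtain ⟨f, hf⟩ := IsSimpleModule.toSpanSingleton_surjective (Module.End K V) hx w
  obtain ⟨a, rfl⟩ := hρ f
  exact ⟨a, hf⟩

end AsModule

section AsModulePi

variable {K A ι : Type*} {V : ι → Type*} [Field K] [Ring A] [Algebra K A]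
  [∀ i, AddCommGroup (V i)] [∀ i, Module K (V i)]
  {ρ : (i : ι) → A →ₐ[K] Module.End K (V i)}

theorem isEmpty_linearEquiv_asModule (hρ : Function.Surjective (AlgHom.pi ρ)) {i j : ι}
    (hij : i ≠ j) [Nontrivial (V i)] : IsEmpty (AsModule (ρ i) ≃ₗ[A] AsModule (ρ j)) := by
  classical
  refine ⟨fun φ => ?_⟩
  obtain ⟨e, he⟩ := hρ (Pi.single i 1)
  have hi : ρ i e = 1 := (congrFun he i).trans (Pi.single_eq_same i 1)
  have hj : ρ j e = 0 := (congrFun he j).trans (Pi.single_eq_of_ne hij.symm 1)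
  obtain ⟨x, hx⟩ := exists_ne (0 : AsModule (ρ i))
  have hex : e • x = x := by rw [smul_asModule, hi]; rfl
  refine hx (φ.map_eq_zero_iff.1 ?_)
  rw [← hex, map_smul, smul_asModule, hj]
  rfl

theorem isSemisimpleRing_of_bijective_pi [Finite ι] [∀ i, FiniteDimensional K (V i)]
    (hρ : Function.Bijective (AlgHom.pi ρ)) : IsSemisimpleRing A := by
  have (i : ι) : IsSemisimpleRing (Module.End K (V i)) := IsSemisimpleRing.moduleEnd K _
  exact (AlgEquiv.ofBijective _ hρ).symm.toRingEquiv.isSemisimpleRing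

variable {M : Type*} [AddCommGroup M] [Module A M]

/-- The homomorphism `V i → M` which sends `w` to `a • z`, where `a : A` acts on `V i` as
`x ↦ φ x • w` and as zero on the other `V j`. -/
noncomputable def homOfVector [DecidableEq ι] (hρ : Function.Bijective (AlgHom.pi ρ)) {i : ι}
    (φ : Module.Dual K (V i)) (z : M) : AsModule (ρ i) →ₗ[A] M where
  toFun w := (AlgEquiv.ofBijective _ hρ).symm (Pi.single i (φ.smulRight (w : V i))) • z
  map_add' w w' := by
    rw [← add_smul, ← map_add, ← Pi.single_add]
    congr 3
    exact (LinearMap.smulRightₗ φ).map_add (w : V i) w'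
  map_smul' a w := by
    rw [RingHom.id_apply, ← mul_smul]
    congr 1
    apply (AlgEquiv.ofBijective _ hρ).injective
    rw [AlgEquiv.apply_symm_apply, map_mul, AlgEquiv.apply_symm_apply, mul_piSingle]
    congr 1
    exact LinearMap.ext fun x => ((ρ i a).map_smul (φ x) w).symm

theorem exists_homOfVector_ne_zero [DecidableEq ι] [Finite ι]
    [∀ i, FiniteDimensional K (V i)] (hρ : Function.Bijective (AlgHom.pi ρ)) {z : M} (hz : z ≠ 0) :
    ∃ (i : ι) (φ : Module.Dual K (V i)), homOfVector hρ φ z ≠ 0 := by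
  have := Fintype.ofFinite ι
  let e := AlgEquiv.ofBijective _ hρ
  let b (i : ι) := Module.finBasis K (V i)
  by_contra! h
  have hone (i : ι) : ∑ k, ((b i).coord k).smulRight (b i k) = 1 :=
    LinearMap.ext fun x => by simp [(b i).sum_repr]
  have hsum : ∑ i, ∑ k, e.symm (Pi.single i (((b i).coord k).smulRight (b i k))) = 1 := by
    apply e.injective
    simp only [map_sum, AlgEquiv.apply_symm_apply, map_one]
    refine Eq.trans (Finset.sum_congr rfl fun i _ => ?_) (Finset.univ_sum_single 1)
    rw [Pi.one_apply, ← hone i]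
    exact (map_sum (AddMonoidHom.single (fun i => Module.End K (V i)) i) _ _).symm
  apply hz
  rw [← one_smul A z, ← hsum]
  simp only [Finset.sum_smul]
  exact Finset.sum_eq_zero fun i _ => Finset.sum_eq_zero fun k _ =>
    LinearMap.congr_fun (h i ((b i).coord k)) (b i k)

theorem exists_linearEquiv_asModule [Finite ι] [∀ i, FiniteDimensional K (V i)]
    [∀ i, Nontrivial (V i)] (hρ : Function.Bijective (AlgHom.pi ρ)) [IsSimpleModule A M] :
    ∃ i, Nonempty (M ≃ₗ[A] AsModule (ρ i)) := by
  classical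
  have := IsSimpleModule.nontrivial A M
  obtain ⟨z, hz⟩ := exists_ne (0 : M)
  obtain ⟨i, φ, hφ⟩ := exists_homOfVector_ne_zero hρ hz
  have := isSimpleModule_asModule (ρ := ρ i)
    ((Function.surjective_eval i).comp hρ.2)
  exact ⟨i, ⟨(LinearEquiv.ofBijective _ (LinearMap.bijective_of_ne_zero hφ)).symm⟩⟩

end AsModulePi

/-! ### Generic parameters -/

section Generic

variable {K : Type*} [Field K] [Algebra ℂ K] {m : ℕ} {q : K} {v : Fin m → K}

theorem aeval_ne_zero_of_transcendental (hq : Transcendental ℂ q) {p : Polynomial ℂ} {x : ℂ}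
    (hp : p.eval x ≠ 0) : Polynomial.aeval q p ≠ 0 := by
  intro hzero
  rw [transcendental_iff.1 hq p hzero, Polynomial.eval_zero] at hp
  exact hp rfl

theorem GenericParameters.pow_mul_ne (G : GenericParameters q v) {j k : Fin m} (hjk : j ≠ k)
    (N : ℕ) : q ^ N * v j ≠ v k := by
  intro h
  have hpoly := algebraicIndependent_iff.1 G
    (MvPolynomial.X none ^ N * MvPolynomial.X (some j) - MvPolynomial.X (some k))
    (by simp [h])
  have heval := congrArg (MvPolynomial.eval
    fun o : Option (Fin m) => if o = some k then (1 : ℂ) else 0) hpoly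
  simp [hjk] at heval

theorem GenericParameters.zpow_mul_ne (G : GenericParameters q v) {j k : Fin m} (hjk : j ≠ k)
    (i : ℤ) : q ^ i * v j ≠ v k := by
  rcases i.eq_nat_or_neg with ⟨N, rfl | rfl⟩
  · rw [zpow_natCast]
    exact G.pow_mul_ne hjk N
  · intro h
    refine G.pow_mul_ne hjk.symm N ?_
    rw [← h, zpow_neg, zpow_natCast, mul_inv_cancel_left₀]
    exact pow_ne_zero N (AlgebraicIndependent.ne_zero G none)

theorem GenericParameters.semisimple (G : GenericParameters q v) (n : ℕ) :
    SemisimpleParameters q v n := by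
  have hq : Transcendental ℂ q := AlgebraicIndependent.transcendental G none
  refine ⟨AlgebraicIndependent.ne_zero G none, fun _ h => ?_, fun N _ => ?_,
    fun i j k hjk _ _ h => G.zpow_mul_ne hjk _ (sub_eq_zero.1 h),
    fun j => AlgebraicIndependent.ne_zero G (some j)⟩
  · refine aeval_ne_zero_of_transcendental hq (p := Polynomial.X ^ 2 - 1) (x := 0) ?_ ?_
    · simp
    · simp [h]
  · have hsum := aeval_ne_zero_of_transcendental hq (x := 1)
      (p := ∑ i ∈ Finset.range (N + 1), Polynomial.X ^ (2 * i))
      (by simpa [Polynomial.eval_finsetSum] using Nat.cast_add_one_ne_zero N)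
    simpa using hsum

end Generic

/-! ### Dimensions -/

section Dimension

variable {K : Type*} [Field K] {m n : ℕ} {q : K} {v : Fin m → K}

theorem finrank_pi_end_tableauSpace (K : Type*) [Field K] (m n : ℕ) :
    Module.finrank K ((lam : MultiPartition m n) → Module.End K (TableauSpace K lam)) =
      ∑ lam : MultiPartition m n, Fintype.card (StandardTableau lam) ^ 2 := by
  rw [Module.finrank_pi_fintype]
  refine Finset.sum_congr rfl fun lam _ => ?_
  rw [Module.finrank_linearMap, Module.finrank_finsupp_self, sq]

theorem sum_card_sq_le_finrank (P : SemisimpleParameters q v n) :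
    ∑ lam : MultiPartition m n, Fintype.card (StandardTableau lam) ^ 2 ≤
      Module.finrank K (HeckeAlgebra q v n) := by
  rw [← finrank_pi_end_tableauSpace K]
  exact LinearMap.finrank_le_finrank_of_surjective (f := (totalRep P).toLinearMap)
    (totalRep_surjective P)

theorem finrank_heckeAlgebra (P : SemisimpleParameters q v n) :
    Module.finrank K (HeckeAlgebra q v n) = n.factorial * m ^ n :=
  (HeckeAlgebra.finrank_le q v n).antisymm
    ((factorial_mul_pow_le_sum_card_sq m n).trans (sum_card_sq_le_finrank P))

theorem sum_card_sq_eq_finrank (P : SemisimpleParameters q v n) :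
    ∑ lam : MultiPartition m n, Fintype.card (StandardTableau lam) ^ 2 =
      Module.finrank K (HeckeAlgebra q v n) :=
  (sum_card_sq_le_finrank P).antisymm
    ((HeckeAlgebra.finrank_le q v n).trans (factorial_mul_pow_le_sum_card_sq m n))

theorem totalRep_bijective (P : SemisimpleParameters q v n) :
    Function.Bijective (totalRep P) := by
  have hdim : Module.finrank K (HeckeAlgebra q v n) = Module.finrank K
      ((lam : MultiPartition m n) → Module.End K (TableauSpace K lam)) := by
    rw [finrank_pi_end_tableauSpace, sum_card_sq_eq_finrank P]
  have hsurj := totalRep_surjective P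
  have hinj : Function.Injective (totalRep P).toLinearMap :=
    (LinearMap.injective_iff_surjective_of_finrank_eq_finrank (V := HeckeAlgebra q v n)
      (V₂ := (lam : MultiPartition m n) → Module.End K (TableauSpace K lam)) hdim).2 hsurj
  exact ⟨hinj, hsurj⟩

theorem finrank_asModule_tableauRep (P : SemisimpleParameters q v n) (lam : MultiPartition m n) :
    Module.finrank K (AsModule (tableauRep P lam)) = Fintype.card (StandardTableau lam) :=
  Module.finrank_finsupp_self K

end Dimension

end CyclotomicHecke

theorem mainTheorem1_general {K : Type*} [Field K] (m n : ℕ) (q : K) (v : Fin m → K)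
    (P : SemisimpleParameters q v n) :
    ∃ ρ : (lam : MultiPartition m n) →
        (HeckeAlgebra q v n →ₐ[K] Module.End K (TableauSpace K lam)),
      (∀ lam, (∀ h : 0 < n, ρ lam (tau q v h) = tauOp q v lam h) ∧
        (∀ (i : ℕ) (h : i + 1 < n), ρ lam (sigma q v i h) = sigmaOp q v lam i h)) ∧
      (∀ (lam : MultiPartition m n) (X : StandardTableau lam) (i : ℕ) (h : i + 1 < n),
        content q v X ⟨i, Nat.lt_of_succ_lt h⟩ ≠ content q v X ⟨i + 1, h⟩) ∧
      (∀ lam, IsSimpleModule (HeckeAlgebra q v n) (AsModule (ρ lam))) ∧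
      (∀ lam mu, lam ≠ mu →
        IsEmpty (AsModule (ρ lam) ≃ₗ[HeckeAlgebra q v n] AsModule (ρ mu))) ∧
      Module.Finite K (HeckeAlgebra q v n) ∧
      (∑ lam : MultiPartition m n, Module.finrank K (AsModule (ρ lam)) ^ 2 =
        Module.finrank K (HeckeAlgebra q v n)) ∧
      Module.finrank K (HeckeAlgebra q v n) = n.factorial * m ^ n ∧
      (∀ (M : Type*) [AddCommGroup M] [Module (HeckeAlgebra q v n) M],
        IsSimpleModule (HeckeAlgebra q v n) M →
          ∃ lam, Nonempty (M ≃ₗ[HeckeAlgebra q v n] AsModule (ρ lam))) ∧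
      IsSemisimpleRing (HeckeAlgebra q v n) := by
  have hbij : Function.Bijective (AlgHom.pi (tableauRep P)) := totalRep_bijective P
  refine ⟨tableauRep P, fun lam => ⟨tableauRep_tau P lam, fun i h => tableauRep_sigma P lam h⟩,
    fun lam X i h => X.content_ne P (Nat.lt_succ_self i) (by simp), fun lam => ?_,
    fun lam mu hne => isEmpty_linearEquiv_asModule hbij.2 hne, inferInstance, ?_,
    finrank_heckeAlgebra P, fun M _ _ _ => exists_linearEquiv_asModule hbij,
    isSemisimpleRing_of_bijective_pi hbij⟩
  · exact isSimpleModule_asModule ((Function.surjective_eval lam).comp hbij.2)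
  · simp only [finrank_asModule_tableauRep, sum_card_sq_eq_finrank P]

theorem mainTheorem1 {K : Type*} [Field K] [Algebra ℂ K] (m n : ℕ)
    (q : K) (v : Fin m → K)
    (hqv : SemisimpleParameters q v n ∨ GenericParameters q v) :
    ∃ ρ : (lam : MultiPartition m n) →
        (HeckeAlgebra q v n →ₐ[K] Module.End K (TableauSpace K lam)),
      -- the `ρ lam` are the representations given by the formulas on standard tableaux
      (∀ lam, (∀ h : 0 < n, ρ lam (tau q v h) = tauOp q v lam h) ∧
        (∀ (i : ℕ) (h : i + 1 < n), ρ lam (sigma q v i h) = sigmaOp q v lam i h)) ∧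
      -- the denominators in these formulas do not vanish
      (∀ (lam : MultiPartition m n) (X : StandardTableau lam) (i : ℕ) (h : i + 1 < n),
        content q v X ⟨i, Nat.lt_of_succ_lt h⟩ ≠ content q v X ⟨i + 1, h⟩) ∧
      -- they are irreducible
      (∀ lam, IsSimpleModule (HeckeAlgebra q v n) (AsModule (ρ lam))) ∧
      -- and pairwise non-isomorphic
      (∀ lam mu, lam ≠ mu →
        IsEmpty (AsModule (ρ lam) ≃ₗ[HeckeAlgebra q v n] AsModule (ρ mu))) ∧
      -- the sum of the squares of the dimensions is `dim H(m,1,n) = n! mⁿ`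
      Module.Finite K (HeckeAlgebra q v n) ∧
      (∑ lam : MultiPartition m n, Module.finrank K (AsModule (ρ lam)) ^ 2 =
        Module.finrank K (HeckeAlgebra q v n)) ∧
      Module.finrank K (HeckeAlgebra q v n) = n.factorial * m ^ n ∧
      -- every irreducible representation is one of them
      (∀ (M : Type*) [AddCommGroup M] [Module (HeckeAlgebra q v n) M],
        IsSimpleModule (HeckeAlgebra q v n) M →
          ∃ lam, Nonempty (M ≃ₗ[HeckeAlgebra q v n] AsModule (ρ lam))) ∧
      -- and `H(m,1,n)` is semisimple
      IsSemisimpleRing (HeckeAlgebra q v n) :=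
  mainTheorem1_general m n q v (hqv.elim id fun G => G.semisimple n)
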